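/- Let $A$ be a nonzero separable C*-algebra and let $\mathfrak r=(\rho_n)_{n\in\mathbb N}$ be a sequence of non-degenerate $*$-endomorphisms of $A$ (that is, $\rho_n(A)A$ spans a dense subspace of $A$) such that 1. $\limsup_{n\to\infty}\|\rho_n(a)\|=\|a\|$ for every $a\in A$; 2. the only closed two-sided ideals $I\subset A$ with $\rho_n(I)\subset I$ for all $n\in\mathbb N$ are $I=0$ and $I=A$. Let $\mathcal E=\ell^2(\mathbb N)\otimes A$ be the right Hilbert $A$-module of families $\xi=(\xi_n)_{n\in\mathbb N}$ in $A$ with $\sum_n\xi_n^*\xi_n$ norm convergent, with $\langle\xi,\eta\rangle=\sum_n\xi_n^*\eta_n$, regarded as a C*-correspondence over $A$ with the left action $(a\xi)_n=\rho_n(a)\xi_n$. Let $\mathcal T_{\mathcal E}$ be its Toeplitz–Pimsner algebra, i.e. the universal C*-algebra generated by a copy of $A$ and elements $T_\xi$, linear in $\xi\in\mathcal E$, subject to $T_{a\xi}=aT_\xi$, $T_{\xi a}=T_\xi a$ and $T_\xi^*T_\eta=\langle\xi,\eta\rangle$. It acts on the full Fock space $F(\mathcal E)=\bigoplus_{n\ge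 0}\mathcal E^{\otimes n}$, where $\mathcal E^{\otimes 0}=A$, by letting $A$ act from the left and $T_\xi$ act as the creation operator $\eta\mapsto\xi\otimes\eta$. The Cuntz–Pimsner algebra $\mathcal O_{\mathcal E}$ is the quotient of $\mathcal T_{\mathcal E}$ by the closed two-sided ideal generated by the elements that act on $F(\mathcal E)$ as elements of $\mathbb K_A(\mathcal E^{\otimes 0})$ (the compact operators on the summand $\mathcal E^{\otimes 0}$, extended by $0$). Then $\mathcal T_{\mathcal E}$ is simple (it is nonzero and has no closed two-sided ideals other than $0$ and itself), and the quotient map $\mathcal T_{\mathcal E}\to\mathcal O_{\mathcal E}$ is an isomorphism. -/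

import Mathlib

open Filter Topology
open scoped ENNReal

noncomputable section

namespace Pimsner

universe u v

section FiniteSums

variable {ι : Type v} {A : Type u} [NonUnitalCStarAlgebra A]

/-- Cauchy--Schwarz for finite families. -/
theorem norm_sum_star_mul_le (s : Finset ι) (x y : ι → A) :
    ‖∑ i ∈ s, star (x i) * y i‖ ≤
      √‖∑ i ∈ s, star (x i) * x i‖ * √‖∑ i ∈ s, star (y i) * y i‖ := by
  let _ := CStarAlgebra.spectralOrder A
  have _ := CStarAlgebra.spectralOrderedRing A
  have h := CStarModule.norm_inner_le (A := A) (WithCStarModule A (s → A))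
    (x := (WithCStarModule.equiv A (s → A)).symm fun i => star (y i))
    (y := (WithCStarModule.equiv A (s → A)).symm fun i => star (x i))
  simp only [WithCStarModule.pi_norm, WithCStarModule.pi_inner, WithCStarModule.inner_def,
    WithCStarModule.equiv_symm_pi_apply, star_star] at h
  rw [Finset.sum_coe_sort s (fun i => star (x i) * y i),
    Finset.sum_coe_sort s (fun i => star (x i) * x i),
    Finset.sum_coe_sort s (fun i => star (y i) * y i), mul_comm] at h
  exact h

theorem norm_sum_mono {s t : Finset ι} (hst : s ⊆ t) (x : ι → A) :
    ‖∑ i ∈ s, star (x i) * x i‖ ≤ ‖∑ i ∈ t, star (x i) * x i‖ := by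
  let _ := CStarAlgebra.spectralOrder A
  have _ := CStarAlgebra.spectralOrderedRing A
  exact CStarAlgebra.norm_le_norm_of_nonneg_of_le
    (Finset.sum_nonneg fun i _ => star_mul_self_nonneg (x i))
    (Finset.sum_le_sum_of_subset_of_nonneg hst fun i _ _ => star_mul_self_nonneg (x i))

theorem summable_star_mul {x y : ι → A} (hx : Summable fun i => star (x i) * x i)
    (hy : Summable fun i => star (y i) * y i) : Summable fun i => star (x i) * y i := by
  rw [summable_iff_vanishing_norm] at hx hy ⊢
  intro ε hε
  classical
  obtain ⟨s, hs⟩ := hx ε hε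
  obtain ⟨t, ht⟩ := hy ε hε
  refine ⟨s ∪ t, fun r hr => ?_⟩
  have h1 := hs r (hr.mono_right Finset.subset_union_left)
  have h2 := ht r (hr.mono_right Finset.subset_union_right)
  calc _ ≤ √‖∑ i ∈ r, star (x i) * x i‖ * √‖∑ i ∈ r, star (y i) * y i‖ :=
        norm_sum_star_mul_le r x y
    _ < √ε * √ε := by
        apply mul_lt_mul'' _ _ (Real.sqrt_nonneg _) (Real.sqrt_nonneg _) <;>
          exact Real.sqrt_lt_sqrt (norm_nonneg _) (by assumption)
    _ = ε := Real.mul_self_sqrt hε.le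

theorem sqrt_norm_sum_add_le (s : Finset ι) (x y : ι → A) :
    √‖∑ i ∈ s, star (x i + y i) * (x i + y i)‖ ≤
      √‖∑ i ∈ s, star (x i) * x i‖ + √‖∑ i ∈ s, star (y i) * y i‖ := by
  refine Real.sqrt_le_iff.2 ⟨by positivity, ?_⟩
  have h : ∑ i ∈ s, star (x i + y i) * (x i + y i) =
      (∑ i ∈ s, star (x i) * x i + ∑ i ∈ s, star (x i) * y i) +
        (∑ i ∈ s, star (y i) * x i + ∑ i ∈ s, star (y i) * y i) := by
    simp only [← Finset.sum_add_distrib]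
    refine Finset.sum_congr rfl fun i _ => ?_
    rw [star_add]
    noncomm_ring
  have h1 := norm_sum_star_mul_le s x y
  have h2 := norm_sum_star_mul_le s y x
  have h3 := Real.sq_sqrt (norm_nonneg (∑ i ∈ s, star (x i) * x i))
  have h4 := Real.sq_sqrt (norm_nonneg (∑ i ∈ s, star (y i) * y i))
  rw [h]
  refine (norm_add_le _ _).trans ((add_le_add (norm_add_le _ _) (norm_add_le _ _)).trans ?_)
  nlinarith

/-- Comparison: a family dominated on finite sets by a square summable one is square summable. -/
theorem summable_of_dominated {x y : ι → A} (hx : Summable fun i => star (x i) * x i) (C : ℝ)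
    (h : ∀ s : Finset ι, ‖∑ i ∈ s, star (y i) * y i‖ ≤ C * ‖∑ i ∈ s, star (x i) * x i‖) :
    Summable fun i => star (y i) * y i := by
  rw [summable_iff_vanishing_norm] at hx ⊢
  intro ε hε
  obtain ⟨s, hs⟩ := hx (ε / (|C| + 1)) (by positivity)
  refine ⟨s, fun t ht => ?_⟩
  calc _ ≤ C * ‖∑ i ∈ t, star (x i) * x i‖ := h t
    _ ≤ (|C| + 1) * ‖∑ i ∈ t, star (x i) * x i‖ := by
        gcongr
        linarith [le_abs_self C]
    _ < (|C| + 1) * (ε / (|C| + 1)) := by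
        gcongr
        exact hs t ht
    _ = ε := by field_simp

end FiniteSums

section StandardModule

/-- The families in `A` with `∑ i, (x i)⋆ (x i)` convergent in norm. -/
def l2Submodule (ι : Type v) (A : Type u) [NonUnitalCStarAlgebra A] : Submodule ℂ (ι → A) where
  carrier := {x | Summable fun i => star (x i) * x i}
  add_mem' {x y} hx hy := by
    have h := ((hx.add (summable_star_mul hx hy)).add (summable_star_mul hy hx)).add hy
    refine h.congr fun i => ?_
    simp only [Pi.add_apply, star_add]
    noncomm_ring
  zero_mem' := by simp
  smul_mem' c x hx := by
    refine (hx.const_smul (star c * c)).congr fun i => ?_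
    simp only [Pi.smul_apply, star_smul, smul_mul_smul_comm]

/-- The right Hilbert `A`-module `ℓ²(ι) ⊗ A`: the families `x : ι → A` such that
`∑ i, (x i)⋆ (x i)` converges in norm. The vector `δ_i ⊗ a` is the family that is `a` at `i` and
`0` elsewhere. -/
def L2 (ι : Type v) (A : Type u) [NonUnitalCStarAlgebra A] : Type (max u v) :=
  ↥(l2Submodule ι A)

namespace L2

variable {ι : Type v} {A : Type u} [NonUnitalCStarAlgebra A]

instance : AddCommGroup (L2 ι A) := inferInstanceAs (AddCommGroup ↥(l2Submodule ι A))

instance : Module ℂ (L2 ι A) := inferInstanceAs (Module ℂ ↥(l2Submodule ι A))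

instance : CoeFun (L2 ι A) (fun _ => ι → A) := ⟨fun x => x.1⟩

theorem ext {x y : L2 ι A} (h : ∀ i, x i = y i) : x = y := Subtype.ext (funext h)

theorem summable (x : L2 ι A) : Summable fun i => star (x i) * x i := x.2

@[simp] theorem add_apply (x y : L2 ι A) (i : ι) : (x + y) i = x i + y i := rfl
@[simp] theorem sub_apply (x y : L2 ι A) (i : ι) : (x - y) i = x i - y i := rfl
@[simp] theorem zero_apply (i : ι) : (0 : L2 ι A) i = 0 := rfl
@[simp] theorem smul_apply (c : ℂ) (x : L2 ι A) (i : ι) : (c • x) i = c • x i := rfl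

/-- The `A`-valued inner product `⟪x, y⟫ = ∑ i, (x i)⋆ (y i)`. -/
def inner (x y : L2 ι A) : A := ∑' i, star (x i) * y i

theorem hasSum_inner (x y : L2 ι A) : HasSum (fun i => star (x i) * y i) (inner x y) :=
  (summable_star_mul x.summable y.summable).hasSum

theorem inner_add_right (x y z : L2 ι A) : inner x (y + z) = inner x y + inner x z :=
  ((hasSum_inner x (y + z)).unique <| by
    simpa [mul_add] using (hasSum_inner x y).add (hasSum_inner x z))

theorem inner_smul_right (c : ℂ) (x y : L2 ι A) : inner x (c • y) = c • inner x y :=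
  ((hasSum_inner x (c • y)).unique <| by
    simpa [mul_smul_comm] using (hasSum_inner x y).const_smul c)

theorem star_inner (x y : L2 ι A) : star (inner x y) = inner y x :=
  ((hasSum_inner x y).star.unique <| by simpa using hasSum_inner y x)

theorem inner_add_left (x y z : L2 ι A) : inner (x + y) z = inner x z + inner y z := by
  rw [← star_inner, inner_add_right, star_add, star_inner, star_inner]

theorem inner_smul_left (c : ℂ) (x y : L2 ι A) : inner (c • x) y = star c • inner x y := by
  rw [← star_inner, inner_smul_right, star_smul, star_inner]

theorem inner_sub_right (x y z : L2 ι A) : inner x (y - z) = inner x y - inner x z := by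
  rw [eq_sub_iff_add_eq, ← inner_add_right, sub_add_cancel]

theorem inner_sub_left (x y z : L2 ι A) : inner (x - y) z = inner x z - inner y z := by
  rw [eq_sub_iff_add_eq, ← inner_add_left, sub_add_cancel]

theorem norm_sum_le (x : L2 ι A) (s : Finset ι) :
    ‖∑ i ∈ s, star (x i) * x i‖ ≤ ‖inner x x‖ :=
  ge_of_tendsto (hasSum_inner x x).norm
    ((eventually_ge_atTop s).mono fun _ ht => norm_sum_mono ht _)

/-- The norm of a Hilbert module, `‖x‖ = ‖⟪x, x⟫‖ ^ (1/2)`. -/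
instance : Norm (L2 ι A) := ⟨fun x => √‖inner x x‖⟩

theorem norm_def (x : L2 ι A) : ‖x‖ = √‖inner x x‖ := rfl

theorem norm_sq (x : L2 ι A) : ‖x‖ ^ 2 = ‖inner x x‖ := Real.sq_sqrt (norm_nonneg _)

theorem norm_inner_le (x y : L2 ι A) : ‖inner x y‖ ≤ ‖x‖ * ‖y‖ :=
  le_of_tendsto (hasSum_inner x y).norm <| Eventually.of_forall fun s =>
    (norm_sum_star_mul_le s _ _).trans <| mul_le_mul (Real.sqrt_le_sqrt (norm_sum_le x s))
      (Real.sqrt_le_sqrt (norm_sum_le y s)) (Real.sqrt_nonneg _) (Real.sqrt_nonneg _)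

theorem norm_apply_le (x : L2 ι A) (i : ι) : ‖x i‖ ≤ ‖x‖ := by
  have h := norm_sum_le x {i}
  rw [Finset.sum_singleton, CStarRing.norm_star_mul_self, ← sq] at h
  exact Real.le_sqrt_of_sq_le h

theorem normedSpaceCore : NormedSpace.Core ℂ (L2 ι A) where
  norm_nonneg _ := Real.sqrt_nonneg _
  norm_smul c x := by
    have : inner (c • x) (c • x) = (star c * c) • inner x x := by
      rw [inner_smul_right, inner_smul_left, smul_smul, mul_comm]
    rw [norm_def, this, norm_smul, norm_mul, norm_star, Real.sqrt_mul (by positivity),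
      Real.sqrt_mul_self (norm_nonneg _), norm_def]
  norm_triangle x y := by
    have hx : 0 ≤ ‖x‖ := Real.sqrt_nonneg _
    have hy : 0 ≤ ‖y‖ := Real.sqrt_nonneg _
    rw [norm_def]
    refine Real.sqrt_le_iff.2 ⟨by positivity, ?_⟩
    rw [inner_add_left, inner_add_right, inner_add_right]
    calc _ ≤ (‖inner x x‖ + ‖inner x y‖) + (‖inner y x‖ + ‖inner y y‖) :=
          (norm_add_le _ _).trans (add_le_add (norm_add_le _ _) (norm_add_le _ _))
      _ ≤ (‖x‖ ^ 2 + ‖x‖ * ‖y‖) + (‖y‖ * ‖x‖ + ‖y‖ ^ 2) := by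
          rw [norm_sq, norm_sq]
          gcongr <;> apply norm_inner_le
      _ = (‖x‖ + ‖y‖) ^ 2 := by ring
  norm_eq_zero_iff x := by
    constructor
    · intro h
      refine ext fun i => ?_
      have := norm_apply_le x i
      rw [h] at this
      simpa using this
    · rintro rfl
      have : inner (0 : L2 ι A) 0 = 0 := by simp [inner]
      simp [norm_def, this]

instance : NormedAddCommGroup (L2 ι A) := NormedAddCommGroup.ofCore normedSpaceCore

instance : NormedSpace ℂ (L2 ι A) := NormedSpace.ofCore normedSpaceCore

theorem norm_le_of_dominated (x y : L2 ι A) (C : ℝ) (hC : 0 ≤ C)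
    (h : ∀ s : Finset ι, ‖∑ i ∈ s, star (y i) * y i‖ ≤ C ^ 2 * ‖∑ i ∈ s, star (x i) * x i‖) :
    ‖y‖ ≤ C * ‖x‖ := by
  have h1 : ‖inner y y‖ ≤ (C * ‖x‖) ^ 2 := by
    rw [mul_pow, norm_sq]
    refine le_of_tendsto (hasSum_inner y y).norm (Eventually.of_forall fun s => (h s).trans ?_)
    gcongr
    exact norm_sum_le x s
  exact Real.sqrt_le_iff.2 ⟨by positivity, h1⟩

instance : CompleteSpace (L2 ι A) := by
  refine Metric.complete_of_cauchySeq_tendsto fun w hw => ?_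
  have hci : ∀ i, CauchySeq fun n => w n i := fun i => by
    rw [Metric.cauchySeq_iff] at hw ⊢
    intro ε hε
    obtain ⟨N, hN⟩ := hw ε hε
    refine ⟨N, fun m hm n hn => ?_⟩
    have := hN m hm n hn
    rw [dist_eq_norm] at this ⊢
    exact (norm_apply_le (w m - w n) i).trans_lt this
  choose z hz using fun i => cauchySeq_tendsto_of_complete (hci i)
  have key : ∀ ε > 0, ∃ N, ∀ n ≥ N, ∀ s : Finset ι,
      √‖∑ i ∈ s, star (w n i - z i) * (w n i - z i)‖ ≤ ε := by
    intro ε hε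
    rw [Metric.cauchySeq_iff] at hw
    obtain ⟨N, hN⟩ := hw ε hε
    refine ⟨N, fun n hn s => ?_⟩
    have hlim : Tendsto (fun m => √‖∑ i ∈ s, star (w n i - w m i) * (w n i - w m i)‖) atTop
        (𝓝 √‖∑ i ∈ s, star (w n i - z i) * (w n i - z i)‖) := by
      refine (Real.continuous_sqrt.tendsto _).comp (Tendsto.norm (tendsto_finsetSum _ ?_))
      intro i _
      exact (tendsto_const_nhds.sub (hz i)).star.mul (tendsto_const_nhds.sub (hz i))
    refine le_of_tendsto hlim ((eventually_ge_atTop N).mono fun m hm => ?_)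
    have := hN n hn m hm
    rw [dist_eq_norm] at this
    exact (Real.sqrt_le_sqrt (norm_sum_le (w n - w m) s)).trans this.le
  have hmem : Summable fun i => star (w 0 i - z i) * (w 0 i - z i) := by
    rw [summable_iff_vanishing_norm]
    intro ε hε
    obtain ⟨N, hN⟩ := key (√ε / 3) (by positivity)
    have h0 := (w 0 - w N).summable
    rw [summable_iff_vanishing_norm] at h0
    obtain ⟨s, hs⟩ := h0 ((√ε / 3) ^ 2) (by positivity)
    refine ⟨s, fun t ht => ?_⟩
    have h1 := sqrt_norm_sum_add_le t (fun i => w 0 i - w N i) (fun i => w N i - z i)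
    simp only [sub_add_sub_cancel] at h1
    have h2 : √‖∑ i ∈ t, star (w 0 i - w N i) * (w 0 i - w N i)‖ ≤ √ε / 3 :=
      Real.sqrt_le_iff.2 ⟨by positivity, (hs t ht).le⟩
    have h3 := hN N le_rfl t
    refine (Real.sqrt_lt_sqrt_iff (norm_nonneg _)).1 ?_
    have : 0 < √ε := Real.sqrt_pos.2 hε
    linarith
  let d : L2 ι A := ⟨fun i => w 0 i - z i, hmem⟩
  have hd : ∀ i, (w 0 - d) i = z i := fun i => by
    rw [sub_apply]
    exact sub_sub_cancel _ _
  refine ⟨w 0 - d, ?_⟩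
  rw [Metric.tendsto_atTop]
  intro ε hε
  obtain ⟨N, hN⟩ := key (ε / 2) (by positivity)
  refine ⟨N, fun n hn => ?_⟩
  rw [dist_eq_norm]
  have hle : ‖w n - (w 0 - d)‖ ≤ ε / 2 := by
    rw [norm_def]
    refine le_of_tendsto ((Real.continuous_sqrt.tendsto _).comp
      (hasSum_inner (w n - (w 0 - d)) (w n - (w 0 - d))).norm)
      (Eventually.of_forall fun s => ?_)
    simpa only [sub_apply (w n), hd, Function.comp_apply] using hN n hn s
  linarith

theorem ext_inner {x y : L2 ι A} (h : ∀ z, inner z x = inner z y) : x = y := by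
  have h1 : inner (x - y) (x - y) = 0 := by rw [inner_sub_right, h, sub_self]
  have h2 : ‖x - y‖ = 0 := by rw [norm_def, h1, norm_zero, Real.sqrt_zero]
  exact sub_eq_zero.1 (norm_eq_zero.1 h2)

theorem continuous_inner : Continuous fun p : L2 ι A × L2 ι A => inner p.1 p.2 := by
  rw [continuous_iff_continuousAt]
  rintro ⟨x, y⟩
  rw [ContinuousAt, tendsto_iff_norm_sub_tendsto_zero]
  have hlim : Tendsto (fun p : L2 ι A × L2 ι A =>
      ‖p.1 - x‖ * ‖p.2‖ + ‖x‖ * ‖p.2 - y‖) (𝓝 (x, y)) (𝓝 (‖x - x‖ * ‖y‖ + ‖x‖ * ‖y - y‖)) := by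
    refine Continuous.tendsto' ?_ (x, y) _ rfl
    fun_prop
  simp only [sub_self, norm_zero, zero_mul, mul_zero, add_zero] at hlim
  refine squeeze_zero (fun _ => norm_nonneg _) (fun p => ?_) hlim
  have : inner p.1 p.2 - inner x y = inner (p.1 - x) p.2 + inner x (p.2 - y) := by
    rw [inner_sub_left, inner_sub_right]
    abel
  rw [this]
  exact (norm_add_le _ _).trans (add_le_add (norm_inner_le _ _) (norm_inner_le _ _))

/-- The right action of `A`, `(x a)_i = x_i a`. -/
def rsmul (x : L2 ι A) (a : A) : L2 ι A :=
  ⟨fun i => x i * a, by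
    refine ((x.summable.mul_left (star a)).mul_right a).congr fun i => ?_
    simp only [star_mul, mul_assoc]⟩

@[simp] theorem rsmul_apply (x : L2 ι A) (a : A) (i : ι) : rsmul x a i = x i * a := rfl

theorem inner_rsmul_right (x y : L2 ι A) (a : A) : inner x (rsmul y a) = inner x y * a :=
  (hasSum_inner x (rsmul y a)).unique <| by
    simpa [mul_assoc] using (hasSum_inner x y).mul_right a

theorem norm_rsmul_inner_le (x y z : L2 ι A) : ‖rsmul x (inner y z)‖ ≤ ‖x‖ * ‖y‖ * ‖z‖ := by
  have h : ‖rsmul x (inner y z)‖ ≤ ‖x‖ * ‖inner y z‖ := by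
    refine abs_le_of_sq_le_sq' ?_ (by positivity) |>.2
    have e : inner (rsmul x (inner y z)) x = star (inner y z) * inner x x := by
      rw [← star_inner, inner_rsmul_right, star_mul, star_inner, star_inner]
    rw [norm_sq, inner_rsmul_right, e, mul_pow, norm_sq]
    refine (norm_mul_le _ _).trans ((mul_le_mul_of_nonneg_right (norm_mul_le _ _)
      (norm_nonneg _)).trans (le_of_eq ?_))
    rw [norm_star]
    ring
  calc _ ≤ ‖x‖ * ‖inner y z‖ := h
    _ ≤ ‖x‖ * (‖y‖ * ‖z‖) := by
        gcongr
        exact norm_inner_le y z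
    _ = _ := by ring

/-- The vector `δ_i ⊗ a`. -/
def single [DecidableEq ι] (i : ι) (a : A) : L2 ι A :=
  ⟨Pi.single i a, summable_of_ne_finset_zero (s := {i}) fun j hj => by
    have : j ≠ i := by simpa using hj
    simp [Pi.single_eq_of_ne this]⟩

end L2

/-- The bounded adjointable operators on `ℓ²(ι) ⊗ A`, as an algebra of bounded operators. -/
def adjointable (ι : Type v) (A : Type u) [NonUnitalCStarAlgebra A] :
    Subalgebra ℂ (L2 ι A →L[ℂ] L2 ι A) where
  carrier := {S | ∃ T : L2 ι A →L[ℂ] L2 ι A, ∀ x y, L2.inner (S x) y = L2.inner x (T y)}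
  mul_mem' := by
    rintro S S' ⟨T, hT⟩ ⟨T', hT'⟩
    exact ⟨T' * T, fun x y => by simp [hT, hT']⟩
  add_mem' := by
    rintro S S' ⟨T, hT⟩ ⟨T', hT'⟩
    exact ⟨T + T', fun x y => by simp [hT, hT', L2.inner_add_left, L2.inner_add_right]⟩
  algebraMap_mem' c := ⟨star c • 1, fun x y => by
    simp [Algebra.algebraMap_eq_smul_one, L2.inner_smul_left, L2.inner_smul_right]⟩

/-- `𝔹_A(ℓ²(ι) ⊗ A)`, the C*-algebra of bounded adjointable operators, with the operator norm and
the adjoint as involution. -/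
def Adj (ι : Type v) (A : Type u) [NonUnitalCStarAlgebra A] : Type (max u v) :=
  ↥(adjointable ι A)

namespace Adj

variable {ι : Type v} {A : Type u} [NonUnitalCStarAlgebra A]

instance : NormedRing (Adj ι A) := inferInstanceAs (NormedRing ↥(adjointable ι A))

instance : NormedAlgebra ℂ (Adj ι A) := inferInstanceAs (NormedAlgebra ℂ ↥(adjointable ι A))

@[simp] theorem add_apply (S T : Adj ι A) (x : L2 ι A) : (S + T).1 x = S.1 x + T.1 x := rfl
@[simp] theorem mul_apply (S T : Adj ι A) (x : L2 ι A) : (S * T).1 x = S.1 (T.1 x) := rfl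
@[simp] theorem smul_apply (c : ℂ) (S : Adj ι A) (x : L2 ι A) : (c • S).1 x = c • S.1 x := rfl

theorem ext {S T : Adj ι A} (h : ∀ x, S.1 x = T.1 x) : S = T :=
  Subtype.ext (ContinuousLinearMap.ext h)

/-- The adjoint of an adjointable operator. -/
instance : Star (Adj ι A) :=
  ⟨fun S => ⟨S.2.choose, S.1, fun x y => by
    rw [← L2.star_inner, ← S.2.choose_spec, L2.star_inner]⟩⟩

theorem inner_apply_left (S : Adj ι A) (x y : L2 ι A) :
    L2.inner (S.1 x) y = L2.inner x ((star S).1 y) := S.2.choose_spec x y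

theorem eq_star {S T : Adj ι A} (h : ∀ x y, L2.inner (S.1 x) y = L2.inner x (T.1 y)) :
    T = star S :=
  ext fun y => L2.ext_inner fun x => by rw [← h, inner_apply_left]

instance : StarRing (Adj ι A) where
  star_involutive S := (eq_star fun x y => by
    rw [← L2.star_inner, ← inner_apply_left, L2.star_inner]).symm
  star_mul S T := (eq_star fun x y => by
    simp [inner_apply_left]).symm
  star_add S T := (eq_star fun x y => by
    simp [inner_apply_left, L2.inner_add_left, L2.inner_add_right]).symm

instance : StarModule ℂ (Adj ι A) where
  star_smul c S := (eq_star fun x y => by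
    simp [inner_apply_left, L2.inner_smul_left, L2.inner_smul_right]).symm

theorem norm_sq_le (S : Adj ι A) : ‖S‖ ^ 2 ≤ ‖star S * S‖ := by
  have h : ‖S.1‖ ≤ √‖star S * S‖ := by
    refine ContinuousLinearMap.opNorm_le_bound _ (Real.sqrt_nonneg _) fun x => ?_
    refine abs_le_of_sq_le_sq' ?_ (by positivity) |>.2
    rw [L2.norm_sq, inner_apply_left, mul_pow, Real.sq_sqrt (norm_nonneg (star S * S))]
    calc _ ≤ ‖x‖ * ‖(star S * S).1 x‖ := L2.norm_inner_le _ _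
      _ ≤ ‖x‖ * (‖star S * S‖ * ‖x‖) := by
          gcongr
          exact ContinuousLinearMap.le_opNorm _ _
      _ = ‖star S * S‖ * ‖x‖ ^ 2 := by ring
  calc ‖S‖ ^ 2 ≤ √‖star S * S‖ ^ 2 := pow_le_pow_left₀ (norm_nonneg _) h 2
    _ = _ := Real.sq_sqrt (norm_nonneg (star S * S))

instance : CStarRing (Adj ι A) where
  norm_mul_self_le S := by
    rw [← sq]
    exact norm_sq_le S

instance : CompleteSpace (Adj ι A) := by
  refine Metric.complete_of_cauchySeq_tendsto fun w hw => ?_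
  have h1 : CauchySeq fun n => (w n).1 := by
    rw [Metric.cauchySeq_iff] at hw ⊢
    exact hw
  have h2 : CauchySeq fun n => (star (w n)).1 := by
    rw [Metric.cauchySeq_iff] at hw ⊢
    intro ε hε
    obtain ⟨N, hN⟩ := hw ε hε
    refine ⟨N, fun m hm n hn => ?_⟩
    have := hN m hm n hn
    rw [dist_eq_norm, ← norm_star, star_sub] at this
    rw [dist_eq_norm]
    exact this
  obtain ⟨S, hS⟩ := cauchySeq_tendsto_of_complete h1
  obtain ⟨T, hT⟩ := cauchySeq_tendsto_of_complete h2
  have hST : ∀ x y, L2.inner (S x) y = L2.inner x (T y) := fun x y => by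
    have h3 : Tendsto (fun n => L2.inner ((w n).1 x) y) atTop (𝓝 (L2.inner (S x) y)) :=
      (L2.continuous_inner.tendsto (S x, y)).comp
        (((ContinuousLinearMap.apply ℂ (L2 ι A) x).continuous.tendsto S |>.comp hS).prodMk_nhds
          tendsto_const_nhds)
    have h4 : Tendsto (fun n => L2.inner x ((star (w n)).1 y)) atTop (𝓝 (L2.inner x (T y))) :=
      (L2.continuous_inner.tendsto (x, T y)).comp
        (tendsto_const_nhds.prodMk_nhds
          ((ContinuousLinearMap.apply ℂ (L2 ι A) y).continuous.tendsto T |>.comp hT))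
    simp only [← inner_apply_left] at h4
    exact tendsto_nhds_unique h3 h4
  exact ⟨⟨S, T, hST⟩, tendsto_subtype_rng.2 hS⟩

instance : CStarAlgebra (Adj ι A) where

/-- An adjointable operator from a pair of mutually adjoint linear maps, one of them bounded. -/
def ofPair (S T : L2 ι A →ₗ[ℂ] L2 ι A) (C D : ℝ) (hS : ∀ x, ‖S x‖ ≤ C * ‖x‖)
    (hT : ∀ x, ‖T x‖ ≤ D * ‖x‖) (h : ∀ x y, L2.inner (S x) y = L2.inner x (T y)) : Adj ι A :=
  ⟨S.mkContinuous C hS, T.mkContinuous D hT, h⟩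

@[simp] theorem ofPair_apply (S T : L2 ι A →ₗ[ℂ] L2 ι A) (C D : ℝ) (hS : ∀ x, ‖S x‖ ≤ C * ‖x‖)
    (hT : ∀ x, ‖T x‖ ≤ D * ‖x‖) (h : ∀ x y, L2.inner (S x) y = L2.inner x (T y)) (x : L2 ι A) :
    (ofPair S T C D hS hT h).1 x = S x := rfl

/-- The rank one operator `θ_{x,y}(z) = x ⟪y, z⟫`. -/
def rankOne (x y : L2 ι A) : Adj ι A :=
  ofPair
    { toFun := fun z => L2.rsmul x (L2.inner y z)
      map_add' := fun z w => L2.ext fun i => by simp [L2.inner_add_right, mul_add]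
      map_smul' := fun c z => L2.ext fun i => by simp [L2.inner_smul_right, mul_smul_comm] }
    { toFun := fun z => L2.rsmul y (L2.inner x z)
      map_add' := fun z w => L2.ext fun i => by simp [L2.inner_add_right, mul_add]
      map_smul' := fun c z => L2.ext fun i => by simp [L2.inner_smul_right, mul_smul_comm] }
    (‖x‖ * ‖y‖) (‖y‖ * ‖x‖)
    (fun z => L2.norm_rsmul_inner_le x y z) (fun z => L2.norm_rsmul_inner_le y x z)
    (fun z w => by
      change L2.inner (L2.rsmul x (L2.inner y z)) w = L2.inner z (L2.rsmul y (L2.inner x w))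
      rw [L2.inner_rsmul_right, ← L2.star_inner, L2.inner_rsmul_right, star_mul, L2.star_inner,
        L2.star_inner])

end Adj

end StandardModule

section Diagonal

variable {ι : Type v} {A : Type u} [NonUnitalCStarAlgebra A]

theorem norm_map_le (f : A →⋆ₙₐ[ℂ] A) (a : A) : ‖f a‖ ≤ ‖a‖ :=
  NonUnitalStarAlgHom.norm_apply_le f a

theorem diag_dominated (f : ι → A →⋆ₙₐ[ℂ] A) (a : A) (x : ι → A) (s : Finset ι) :
    ‖∑ i ∈ s, star (f i a * x i) * (f i a * x i)‖ ≤ ‖a‖ ^ 2 * ‖∑ i ∈ s, star (x i) * x i‖ := by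
  let _ := CStarAlgebra.spectralOrder A
  have _ := CStarAlgebra.spectralOrderedRing A
  rw [← Real.norm_of_nonneg (sq_nonneg ‖a‖), ← norm_smul, Finset.smul_sum]
  refine CStarAlgebra.norm_le_norm_of_nonneg_of_le
    (Finset.sum_nonneg fun i _ => star_mul_self_nonneg _) (Finset.sum_le_sum fun i _ => ?_)
  have h := CStarAlgebra.star_left_conjugate_le_norm_smul (a := x i)
    (b := star (f i a) * f i a) (IsSelfAdjoint.star_mul_self _)
  calc _ = star (x i) * (star (f i a) * f i a) * x i := by
        rw [star_mul]
        simp only [mul_assoc]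
    _ ≤ ‖star (f i a) * f i a‖ • (star (x i) * x i) := h
    _ ≤ _ := by
        refine smul_le_smul_of_nonneg_right ?_ (star_mul_self_nonneg _)
        rw [CStarRing.norm_star_mul_self, ← sq]
        exact pow_le_pow_left₀ (norm_nonneg _) (norm_map_le (f i) a) 2

/-- The linear map `(x_i)_i ↦ (f_i(a) x_i)_i`. -/
def diagLin (f : ι → A →⋆ₙₐ[ℂ] A) (a : A) : L2 ι A →ₗ[ℂ] L2 ι A where
  toFun x := ⟨fun i => f i a * x i, summable_of_dominated x.summable _ (diag_dominated f a _)⟩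
  map_add' _ _ := L2.ext fun _ => mul_add _ _ _
  map_smul' _ _ := L2.ext fun _ => mul_smul_comm _ _ _

@[simp] theorem diagLin_apply (f : ι → A →⋆ₙₐ[ℂ] A) (a : A) (x : L2 ι A) (i : ι) :
    diagLin f a x i = f i a * x i := rfl

/-- The `*`-homomorphism `⨁ f_i : A → 𝔹_A(ℓ²(ι) ⊗ A)`, which sends `a` to the operator
`δ_i ⊗ b ↦ δ_i ⊗ f_i(a) b`. -/
def diagRep (f : ι → A →⋆ₙₐ[ℂ] A) : A →⋆ₙₐ[ℂ] Adj ι A where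
  toFun a := Adj.ofPair (diagLin f a) (diagLin f (star a)) ‖a‖ ‖star a‖
    (fun x => L2.norm_le_of_dominated x _ _ (norm_nonneg _) (diag_dominated f a x))
    (fun x => L2.norm_le_of_dominated x _ _ (norm_nonneg _) (diag_dominated f (star a) x))
    (fun x y => by simp [L2.inner, map_star, mul_assoc])
  map_smul' c a := Adj.ext fun x => L2.ext fun i => by simp [smul_mul_assoc]
  map_zero' := Adj.ext fun x => L2.ext fun i => by
    rw [Adj.ofPair_apply, diagLin_apply, map_zero, zero_mul]
    rfl
  map_add' a b := Adj.ext fun x => L2.ext fun i => by simp [add_mul]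
  map_mul' a b := Adj.ext fun x => L2.ext fun i => by simp [mul_assoc]
  map_star' a := Adj.eq_star fun x y => by simp [L2.inner, map_star, mul_assoc]

@[simp] theorem diagRep_apply (f : ι → A →⋆ₙₐ[ℂ] A) (a : A) (x : L2 ι A) (i : ι) :
    (diagRep f a).1 x i = f i a * x i := rfl

/-- The vector `∑ i, δ_{g i} ⊗ x_i`, for an injective map `g`. -/
def shiftVec (g : ι → ι) (hg : g.Injective) (x : L2 ι A) : L2 ι A :=
  ⟨Function.extend g x 0, by
    refine (hg.summable_iff ?_).1 ?_
    · intro j hj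
      rw [Function.extend_apply' _ _ _ (by simpa using hj)]
      simp
    · refine x.summable.congr fun i => ?_
      simp [hg.extend_apply]⟩

theorem shiftVec_apply (g : ι → ι) (hg : g.Injective) (x : L2 ι A) (i : ι) :
    shiftVec g hg x (g i) = x i := hg.extend_apply _ _ _

theorem shiftVec_apply' (g : ι → ι) (hg : g.Injective) (x : L2 ι A) (j : ι)
    (hj : ¬∃ i, g i = j) : shiftVec g hg x j = 0 := Function.extend_apply' _ _ _ hj

/-- The isometry `δ_i ⊗ a ↦ δ_{g i} ⊗ a` given by an injective map `g`, as a linear map. -/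
def shiftLin (g : ι → ι) (hg : g.Injective) : L2 ι A →ₗ[ℂ] L2 ι A where
  toFun x := shiftVec g hg x
  map_add' x y := by
    refine L2.ext fun j => ?_
    by_cases hj : ∃ i, g i = j
    · obtain ⟨i, rfl⟩ := hj
      simp only [L2.add_apply, shiftVec_apply]
    · simp only [L2.add_apply, shiftVec_apply' _ _ _ _ hj, add_zero]
  map_smul' c x := by
    refine L2.ext fun j => ?_
    by_cases hj : ∃ i, g i = j
    · obtain ⟨i, rfl⟩ := hj
      simp only [L2.smul_apply, shiftVec_apply, RingHom.id_apply]
    · simp only [L2.smul_apply, shiftVec_apply' _ _ _ _ hj, smul_zero]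

theorem shiftLin_apply (g : ι → ι) (hg : g.Injective) (x : L2 ι A) (i : ι) :
    shiftLin g hg x (g i) = x i := hg.extend_apply _ _ _

theorem shiftLin_apply' (g : ι → ι) (hg : g.Injective) (x : L2 ι A) (j : ι)
    (hj : ¬∃ i, g i = j) : shiftLin g hg x j = 0 := Function.extend_apply' _ _ _ hj

/-- The adjoint of `shiftLin`. -/
def unshiftLin (g : ι → ι) (hg : g.Injective) : L2 ι A →ₗ[ℂ] L2 ι A where
  toFun x := ⟨fun i => x (g i), x.summable.comp_injective hg⟩
  map_add' _ _ := rfl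
  map_smul' _ _ := rfl

@[simp] theorem unshiftLin_apply (g : ι → ι) (hg : g.Injective) (x : L2 ι A) (i : ι) :
    unshiftLin g hg x i = x (g i) := rfl

theorem inner_shiftLin (g : ι → ι) (hg : g.Injective) (x y : L2 ι A) :
    L2.inner (shiftLin g hg x) y = L2.inner x (unshiftLin g hg y) := by
  refine (L2.hasSum_inner (shiftLin g hg x) y).unique ?_
  refine (hg.hasSum_iff ?_).1 ?_
  · intro j hj
    rw [shiftLin_apply' g hg x j (by simpa using hj), star_zero, zero_mul]
  · refine (L2.hasSum_inner x (unshiftLin g hg y)).congr_fun fun i => ?_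
    simp [shiftLin_apply]

theorem unshiftLin_shiftLin (g : ι → ι) (hg : g.Injective) (x : L2 ι A) :
    unshiftLin g hg (shiftLin g hg x) = x :=
  L2.ext fun i => by rw [unshiftLin_apply, shiftLin_apply]

theorem norm_shiftLin (g : ι → ι) (hg : g.Injective) (x : L2 ι A) : ‖shiftLin g hg x‖ = ‖x‖ := by
  rw [L2.norm_def, inner_shiftLin, unshiftLin_shiftLin, L2.norm_def]

theorem norm_unshiftLin_le (g : ι → ι) (hg : g.Injective) (x : L2 ι A) :
    ‖unshiftLin g hg x‖ ≤ ‖x‖ := by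
  have h : ‖unshiftLin g hg x‖ ^ 2 ≤ ‖unshiftLin g hg x‖ * ‖x‖ := by
    rw [L2.norm_sq, ← inner_shiftLin]
    exact (L2.norm_inner_le _ _).trans (by rw [norm_shiftLin])
  by_contra! hlt
  nlinarith [norm_nonneg x]

/-- The isometry `δ_i ⊗ a ↦ δ_{g i} ⊗ a` given by an injective map `g`. -/
def shift (g : ι → ι) (hg : g.Injective) : Adj ι A :=
  Adj.ofPair (shiftLin g hg) (unshiftLin g hg) 1 1
    (fun x => by rw [norm_shiftLin, one_mul])
    (fun x => by rw [one_mul]; exact norm_unshiftLin_le g hg x) (inner_shiftLin g hg)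

theorem shift_apply (g : ι → ι) (hg : g.Injective) (x : L2 ι A) (i : ι) :
    (shift g hg).1 x (g i) = x i := hg.extend_apply _ _ _

theorem shift_apply' (g : ι → ι) (hg : g.Injective) (x : L2 ι A) (j : ι)
    (hj : ¬∃ i, g i = j) : (shift g hg).1 x j = 0 := Function.extend_apply' _ _ _ hj

theorem star_shift_apply (g : ι → ι) (hg : g.Injective) (x : L2 ι A) (i : ι) :
    (star (shift g hg)).1 x i = x (g i) := by
  have h : Adj.ofPair (unshiftLin g hg) (shiftLin g hg) 1 1
      (fun x => by rw [one_mul]; exact norm_unshiftLin_le g hg x)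
      (fun x => by rw [norm_shiftLin, one_mul])
      (fun x y => by rw [← L2.star_inner, ← inner_shiftLin, L2.star_inner]) =
      star (shift (A := A) g hg) := Adj.eq_star (inner_shiftLin g hg)
  rw [← h]
  rfl

end Diagonal

section Toeplitz

variable {ι : Type v} {A : Type u} [NonUnitalCStarAlgebra A]

/-- A Toeplitz representation of the C*-correspondence `E = ℓ²(ι) ⊗ A` over `A` with left action
`φ`: a C*-algebra `B` with a `*`-homomorphism `π : A → B` and elements `t ξ = T_ξ` of `B` for
`ξ ∈ E`, satisfying `T_{aξ} = a T_ξ`, `T_{ξa} = T_ξ a`, linearity in `ξ` and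
`T_ξ⋆ T_η = ⟪ξ, η⟫`. -/
structure ToeplitzRep (φ : A →⋆ₙₐ[ℂ] Adj ι A) where
  B : Type (max u v)
  [inst : NonUnitalCStarAlgebra B]
  π : A →⋆ₙₐ[ℂ] B
  t : L2 ι A →ₗ[ℂ] B
  t_left : ∀ (a : A) (ξ : L2 ι A), t ((φ a).1 ξ) = π a * t ξ
  t_right : ∀ (ξ : L2 ι A) (a : A), t (L2.rsmul ξ a) = t ξ * π a
  t_inner : ∀ ξ η : L2 ι A, star (t ξ) * t η = π (L2.inner ξ η)

namespace ToeplitzRep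

variable {φ : A →⋆ₙₐ[ℂ] Adj ι A}

instance (r : ToeplitzRep φ) : NonUnitalCStarAlgebra r.B := r.inst

theorem norm_π_le (r : ToeplitzRep φ) (a : A) : ‖r.π a‖ ≤ ‖a‖ :=
  NonUnitalStarAlgHom.norm_apply_le r.π a

theorem norm_t_le (r : ToeplitzRep φ) (ξ : L2 ι A) : ‖r.t ξ‖ ≤ ‖ξ‖ := by
  refine abs_le_of_sq_le_sq' ?_ (norm_nonneg ξ) |>.2
  rw [sq, ← CStarRing.norm_star_mul_self, r.t_inner, L2.norm_sq]
  exact r.norm_π_le _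

end ToeplitzRep

variable (φ : A →⋆ₙₐ[ℂ] Adj ι A)

/-- The C*-algebraic product of all Toeplitz representations (the bounded families). -/
abbrev ToeplitzProduct : Type (max (u + 1) (v + 1)) := lp (fun r : ToeplitzRep φ => r.B) ∞

/-- The family `(π(a))_{(π, t)}`. -/
def univA (a : A) : ToeplitzProduct φ :=
  ⟨fun r => r.π a, memℓp_infty ⟨‖a‖, by rintro _ ⟨r, rfl⟩; exact r.norm_π_le a⟩⟩

/-- The family `(t(ξ))_{(π, t)}`. -/
def univT (ξ : L2 ι A) : ToeplitzProduct φ :=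
  ⟨fun r => r.t ξ, memℓp_infty ⟨‖ξ‖, by rintro _ ⟨r, rfl⟩; exact r.norm_t_le ξ⟩⟩

/-- The Toeplitz--Pimsner algebra, as a C*-subalgebra of the product of all Toeplitz
representations: it is generated by the families `(π(a))` and `(t(ξ))`. -/
def toeplitzSubalgebra : NonUnitalStarSubalgebra ℂ (ToeplitzProduct φ) :=
  (NonUnitalStarAlgebra.adjoin ℂ
    (Set.range (univA φ) ∪ Set.range (univT φ))).topologicalClosure

instance : IsClosed (toeplitzSubalgebra φ : Set (ToeplitzProduct φ)) :=
  NonUnitalStarSubalgebra.isClosed_topologicalClosure _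

/-- The Toeplitz--Pimsner algebra `𝒯_E`, the universal C*-algebra generated by a copy of `A` and
elements `T_ξ`, `ξ ∈ E`, subject to the relations of a Toeplitz representation: every Toeplitz
representation factors through it by the corresponding coordinate projection. -/
abbrev ToeplitzPimsner : Type (max (u + 1) (v + 1)) := ↥(toeplitzSubalgebra φ)

/-- The copy of `a ∈ A` in `𝒯_E`. -/
def ToeplitzPimsner.ofA (a : A) : ToeplitzPimsner φ :=
  ⟨univA φ a, NonUnitalStarSubalgebra.le_topologicalClosure _
    (NonUnitalStarAlgebra.subset_adjoin ℂ _ (Or.inl ⟨a, rfl⟩))⟩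

/-- The generator `T_ξ` of `𝒯_E`. -/
def ToeplitzPimsner.T (ξ : L2 ι A) : ToeplitzPimsner φ :=
  ⟨univT φ ξ, NonUnitalStarSubalgebra.le_topologicalClosure _
    (NonUnitalStarAlgebra.subset_adjoin ℂ _ (Or.inr ⟨ξ, rfl⟩))⟩

/-- The `*`-homomorphism `𝒯_E → B` induced by a Toeplitz representation. -/
def ToeplitzPimsner.lift (r : ToeplitzRep φ) : ToeplitzPimsner φ →⋆ₙₐ[ℂ] r.B where
  toFun x := x.1.1 r
  map_smul' _ _ := rfl
  map_zero' := rfl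
  map_add' _ _ := rfl
  map_mul' _ _ := rfl
  map_star' _ := rfl

theorem ToeplitzPimsner.lift_ofA (r : ToeplitzRep φ) (a : A) :
    ToeplitzPimsner.lift φ r (ToeplitzPimsner.ofA φ a) = r.π a := rfl

theorem ToeplitzPimsner.lift_T (r : ToeplitzRep φ) (ξ : L2 ι A) :
    ToeplitzPimsner.lift φ r (ToeplitzPimsner.T φ ξ) = r.t ξ := rfl

end Toeplitz

section Fock

variable {A : Type u} [NonUnitalCStarAlgebra A] (ρ : ℕ → A →⋆ₙₐ[ℂ] A)

/-- `ρ_𝔫 = ρ_{i_n} ∘ ⋯ ∘ ρ_{i_1}` for a word `𝔫 = (i_1, …, i_n)`. -/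
def wordEnd : List ℕ → A →⋆ₙₐ[ℂ] A
  | [] => NonUnitalStarAlgHom.id ℂ A
  | i :: w => (wordEnd w).comp (ρ i)

/-- The left action `⨁ ρ_n` of `A` on `ℓ²(ℕ) ⊗ A`. -/
def leftAction : A →⋆ₙₐ[ℂ] Adj ℕ A := diagRep ρ

/-- The left action `a (δ_𝔫 ⊗ b) = δ_𝔫 ⊗ ρ_𝔫(a) b` of `A` on the full Fock space. The Fock space
is written as `ℓ²(𝔑) ⊗ A` with `𝔑 = List ℕ` the set of finite words, where `E^{⊗ n}` is
`ℓ²(ℕ^n) ⊗ A`. -/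
def fockLeft : A →⋆ₙₐ[ℂ] Adj (List ℕ) A := diagRep (wordEnd ρ)

/-- The isometry `δ_𝔫 ⊗ b ↦ δ_{i𝔫} ⊗ b`. -/
def fockShift (i : ℕ) : Adj (List ℕ) A := shift (List.cons i) List.cons_injective

/-- The creation operator of `ξ = ∑ i, δ_i ⊗ ξ_i`, the sum over `i` of the operators
`δ_𝔫 ⊗ b ↦ δ_{i𝔫} ⊗ ρ_𝔫(ξ_i) b`, that is `η ↦ ξ ⊗ η`. -/
def creation (ξ : L2 ℕ A) : Adj (List ℕ) A := ∑' i, fockShift i * fockLeft ρ (ξ i)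

theorem fockLeft_mul_shift (a : A) (i : ℕ) :
    fockLeft ρ a * fockShift i = fockShift i * fockLeft ρ (ρ i a) := by
  refine Adj.ext fun x => L2.ext fun w => ?_
  cases w with
  | nil =>
    change wordEnd ρ [] a * (fockShift i).1 x [] = (fockShift i).1 _ []
    rw [fockShift, shift_apply' _ _ _ _ (by simp), shift_apply' _ _ _ _ (by simp), mul_zero]
  | cons j w =>
    change wordEnd ρ (j :: w) a * (fockShift i).1 x (j :: w) = (fockShift i).1 _ (j :: w)
    by_cases h : i = j
    · subst h
      rw [fockShift, shift_apply (List.cons i) List.cons_injective x w,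
        shift_apply (List.cons i) List.cons_injective _ w]
      rfl
    · rw [fockShift, shift_apply' _ _ _ _ (by simp [h]), shift_apply' _ _ _ _ (by simp [h]),
        mul_zero]

theorem star_shift_mul_shift (i j : ℕ) :
    star (fockShift i) * fockShift j = if i = j then (1 : Adj (List ℕ) A) else 0 := by
  refine Adj.ext fun x => L2.ext fun w => ?_
  rw [Adj.mul_apply, fockShift, star_shift_apply]
  split_ifs with h
  · subst h
    exact shift_apply (List.cons i) List.cons_injective x w
  · rw [fockShift, shift_apply' _ _ _ _ (by simp [Ne.symm h])]
    rfl

theorem star_sum_mul_sum (x y : ℕ → A) (s : Finset ℕ) :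
    star (∑ i ∈ s, fockShift i * fockLeft ρ (x i)) * (∑ i ∈ s, fockShift i * fockLeft ρ (y i)) =
      fockLeft ρ (∑ i ∈ s, star (x i) * y i) := by
  have h : ∀ i j, star (fockShift i * fockLeft ρ (x i)) * (fockShift j * fockLeft ρ (y j)) =
      if i = j then fockLeft ρ (star (x i) * y j) else 0 := fun i j => by
    have : star (fockShift i * fockLeft ρ (x i)) * (fockShift j * fockLeft ρ (y j)) =
        star (fockLeft ρ (x i)) * (star (fockShift i) * fockShift j) * fockLeft ρ (y j) := by
      rw [star_mul]
      simp only [mul_assoc]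
    rw [this, star_shift_mul_shift]
    split_ifs <;> simp [map_star]
  rw [star_sum, Finset.sum_mul_sum, map_sum]
  refine Finset.sum_congr rfl fun i hi => ?_
  simp only [h]
  rw [Finset.sum_ite_eq, if_pos hi]

theorem summable_creation (ξ : L2 ℕ A) : Summable fun i => fockShift i * fockLeft ρ (ξ i) := by
  have hs := ξ.summable
  rw [summable_iff_vanishing_norm] at hs ⊢
  intro ε hε
  obtain ⟨s, hs⟩ := hs (ε ^ 2) (by positivity)
  refine ⟨s, fun t ht => ?_⟩
  refine lt_of_pow_lt_pow_left₀ 2 hε.le ?_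
  rw [sq, ← CStarRing.norm_star_mul_self, star_sum_mul_sum]
  exact (NonUnitalStarAlgHom.norm_apply_le (fockLeft ρ) _).trans_lt (hs t ht)

theorem hasSum_creation (ξ : L2 ℕ A) :
    HasSum (fun i => fockShift i * fockLeft ρ (ξ i)) (creation ρ ξ) :=
  (summable_creation ρ ξ).hasSum

theorem continuous_fockLeft : Continuous (fockLeft ρ) :=
  AddMonoidHomClass.continuous_of_bound (fockLeft ρ) 1 fun a => by
    rw [one_mul]
    exact NonUnitalStarAlgHom.norm_apply_le (fockLeft ρ) a

/-- The representation of `A` and of the creation operators on the full Fock space. -/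
def fockRep : ToeplitzRep (leftAction ρ) where
  B := Adj (List ℕ) A
  π := fockLeft ρ
  t :=
    { toFun := creation ρ
      map_add' := fun ξ η => (hasSum_creation ρ (ξ + η)).unique <| by
        simpa [mul_add] using (hasSum_creation ρ ξ).add (hasSum_creation ρ η)
      map_smul' := fun c ξ => (hasSum_creation ρ (c • ξ)).unique <| by
        simpa [mul_smul_comm] using (hasSum_creation ρ ξ).const_smul c }
  t_left a ξ := (hasSum_creation ρ ((leftAction ρ a).1 ξ)).unique <| by
    refine ((hasSum_creation ρ ξ).mul_left (fockLeft ρ a)).congr_fun fun i => ?_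
    rw [← mul_assoc, fockLeft_mul_shift, mul_assoc, ← map_mul]
    rfl
  t_right ξ a := (hasSum_creation ρ (L2.rsmul ξ a)).unique <| by
    simpa [mul_assoc] using (hasSum_creation ρ ξ).mul_right (fockLeft ρ a)
  t_inner ξ η := by
    have h1 : Tendsto (fun s : Finset ℕ => ∑ i ∈ s, fockShift i * fockLeft ρ (ξ i)) atTop
        (𝓝 (creation ρ ξ)) := hasSum_creation ρ ξ
    have h2 : Tendsto (fun s : Finset ℕ => ∑ i ∈ s, fockShift i * fockLeft ρ (η i)) atTop
        (𝓝 (creation ρ η)) := hasSum_creation ρ η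
    have h3 : Tendsto (fun s : Finset ℕ => fockLeft ρ (∑ i ∈ s, star (ξ i) * η i)) atTop
        (𝓝 (fockLeft ρ (L2.inner ξ η))) :=
      ((continuous_fockLeft ρ).tendsto _).comp (L2.hasSum_inner ξ η)
    have h4 := h1.star.mul h2
    simp only [star_sum_mul_sum] at h4
    exact tendsto_nhds_unique h4 h3

theorem hasSum_creation_apply (ξ : L2 ℕ A) (η : L2 (List ℕ) A) (w : List ℕ) :
    HasSum (fun i => (fockShift i).1 ((fockLeft ρ (ξ i)).1 η) w) ((creation ρ ξ).1 η w) := by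
  let ev : Adj (List ℕ) A →+ A :=
    { toFun := fun S => S.1 η w
      map_zero' := rfl
      map_add' := fun _ _ => rfl }
  have hev : Continuous ev := AddMonoidHomClass.continuous_of_bound ev ‖η‖ fun S => by
    rw [mul_comm]
    exact (L2.norm_apply_le (S.1 η) w).trans (ContinuousLinearMap.le_opNorm S.1 η)
  exact (hasSum_creation ρ ξ).map ev hev

theorem creation_apply_nil (ξ : L2 ℕ A) (η : L2 (List ℕ) A) : (creation ρ ξ).1 η [] = 0 := by
  refine (hasSum_creation_apply ρ ξ η []).unique ?_
  have h : ∀ i, (fockShift i).1 ((fockLeft ρ (ξ i)).1 η) [] = 0 := fun i =>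
    shift_apply' (List.cons i) List.cons_injective _ _ (by simp)
  simpa only [h] using hasSum_zero (α := A) (β := ℕ)

theorem creation_apply_cons (ξ : L2 ℕ A) (η : L2 (List ℕ) A) (i : ℕ) (w : List ℕ) :
    (creation ρ ξ).1 η (i :: w) = wordEnd ρ w (ξ i) * η w := by
  refine (hasSum_creation_apply ρ ξ η (i :: w)).unique ?_
  have h := hasSum_single (f := fun j => (fockShift j).1 ((fockLeft ρ (ξ j)).1 η) (i :: w)) i
    fun j hj => shift_apply' (List.cons j) List.cons_injective _ _ (by simp [hj])
  have h' : (fockShift i).1 ((fockLeft ρ (ξ i)).1 η) (i :: w) = wordEnd ρ w (ξ i) * η w :=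
    shift_apply (List.cons i) List.cons_injective _ w
  rw [← h']
  exact h

/-- `𝕂_A(E^{⊗ 0})` as a subspace of `𝔹_A(F(E))`: the closed span of the rank one operators
`θ_{x,y}` with `x, y` in `E^{⊗ 0} = δ_∅ ⊗ A`. -/
def vacuumCompacts (A : Type u) [NonUnitalCStarAlgebra A] : Submodule ℂ (Adj (List ℕ) A) :=
  (Submodule.span ℂ {S | ∃ a b : A,
    S = Adj.rankOne (L2.single [] a) (L2.single [] b)}).topologicalClosure

/-- The kernel of the quotient map `𝒯_E → 𝒪_E`: the closed two-sided ideal generated by the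
elements of `𝒯_E` that act on the full Fock space as elements of `𝕂_A(E^{⊗ 0})`. -/
def cuntzPimsnerIdeal : TwoSidedIdeal (ToeplitzPimsner (leftAction ρ)) :=
  sInf {I | IsClosed (I : Set (ToeplitzPimsner (leftAction ρ))) ∧
    ∀ x, (ToeplitzPimsner.lift (leftAction ρ) (fockRep ρ) x : Adj (List ℕ) A) ∈ vacuumCompacts A →
      x ∈ I}

/-- The Cuntz--Pimsner algebra `𝒪_E`, as a quotient of `𝒯_E`. -/
abbrev CuntzPimsner : Type (u + 1) := (cuntzPimsnerIdeal ρ).ringCon.Quotient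

/-- The quotient map `𝒯_E → 𝒪_E`. -/
def toCuntzPimsner : ToeplitzPimsner (leftAction ρ) →ₙ+* CuntzPimsner ρ where
  toFun x := (x : CuntzPimsner ρ)
  map_mul' _ _ := rfl
  map_zero' := rfl
  map_add' _ _ := rfl

end Fock

section Simplicity

/-- A C*-algebra is simple if it is nonzero and `0` and itself are its only closed two-sided
ideals. -/
def IsSimpleCStar (B : Type v) [NonUnitalCStarAlgebra B] : Prop :=
  Nontrivial B ∧ ∀ I : TwoSidedIdeal B, IsClosed (I : Set B) → I = ⊥ ∨ I = ⊤

/-- A `*`-homomorphism `f : A → B` is non-degenerate if `f(A) B` spans a dense subspace of `B`. -/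
def IsNondegenerate {A : Type u} {B : Type v} [NonUnitalCStarAlgebra A]
    [NonUnitalCStarAlgebra B] (f : A →⋆ₙₐ[ℂ] B) : Prop :=
  Dense (Submodule.span ℂ {x : B | ∃ (a : A) (b : B), x = f a * b} : Set B)

end Simplicity

end Pimsner

end

noncomputable section

namespace Pimsner

universe u v w

/-! ### Approximate units -/

section ApproximateUnit

variable (A : Type u) [NonUnitalCStarAlgebra A]

/-! Two facts carry the proof: the representation `F` of the Toeplitz algebra on the Fock space is
faithful, and the vacuum corner of an element is detected by compressing it with generators of large
index.

Faithfulness (`FockCover.norm_F`). Every element is a limit of sums of `u v⋆` with words `u`, `v`.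
For finitely many letters and bounded length, the terms of gauge degree zero span a `*`-algebra, on
which `F` is bounded below by induction on the length: the vacuum corner controls the component in
`A`, and compression by generators shortens the words in the rest. A polynomial of degree `d` is a
sum of `2d + 1` homogeneous components, and the image of each under `F` is a Fourier coefficient for
the gauge unitaries of the Fock space. The constants obtained in this way are poor, but the
estimates also hold for the powers `z ^ 2 ^ k` of a self-adjoint `z`, with constants at most
proportional to `2 ^ k`; taking roots improves them to `1` (`norm_le_norm_map_of_growth`).

Simplicity. Let `J` be a closed ideal. From `S_k(e)⋆ a S_k(e) = e⋆ ρ_k(a) e` it follows that `J ∩ A`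
is invariant under every `ρ_k`, hence is `0` or `A`. If it is `A`, then `J` contains all generators.
If it is `0`, then `A` stays isometric modulo `J` (`norm_le_norm_sub_of_mem`). Approximate `x ∈ J`
by a polynomial `y` with component `a` in `A`. When `k` exceeds every letter of `y`, compression by
`S_k(e)` kills all terms of `y` except `a`, so `ρ_k(a)` is nearly in `J` and therefore small. The
limsup condition provides such `k` with `‖ρ_k(a)‖` close to `‖a‖`, so `a` is small, and the vacuum
corner of `F x` vanishes (`FockCover.vacuum_eq_zero`). Multiplying by generators moves any matrix
coefficient to the vacuum, and non-degeneracy ensures that enough vectors are reached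
(`FockCover.F_eq_zero_of_vacuum`). Hence `F x = 0` and `x = 0`.

The quotient map. If `F x` is a compact operator on the vacuum summand, then `x S_k(e) = 0`, all
compressions vanish, and the same detection argument kills the vacuum corner, which is the only
possible nonzero entry of `F x`. So the ideal defining the Cuntz–Pimsner algebra is zero. -/

theorem exists_selfAdjoint_approximateUnit : ∃ l : Filter A, l.NeBot ∧ (∀ᶠ e in l, ‖e‖ ≤ 1) ∧
    (∀ᶠ e in l, star e = e) ∧ (∀ a, Tendsto (fun e => e * a) l (𝓝 a)) ∧
    ∀ a, Tendsto (fun e => a * e) l (𝓝 a) := by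
  let _ := CStarAlgebra.spectralOrder A
  have _ := CStarAlgebra.spectralOrderedRing A
  have h := CStarAlgebra.increasingApproximateUnit A
  exact ⟨_, h.neBot, h.eventually_norm, h.eventually_star_eq, h.tendsto_mul_right,
    h.tendsto_mul_left⟩

/-- A contractive approximate unit, in the form in which it is used below. -/
theorem exists_approximateUnit : ∃ l : Filter A, l.NeBot ∧ (∀ᶠ e in l, ‖e‖ ≤ 1) ∧
    (∀ a, Tendsto (fun e => a * e) l (𝓝 a)) ∧
    (∀ a, Tendsto (fun e => e * (star e * a)) l (𝓝 a)) ∧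
    (∀ a, Tendsto (fun e => a * e * star e) l (𝓝 a)) ∧
    ∀ a, Tendsto (fun e => star e * a * e) l (𝓝 a) := by
  obtain ⟨l, h0, h1, h2, h3, h4⟩ := exists_selfAdjoint_approximateUnit A
  -- Multiplying a net that tends to `a` by the approximate unit keeps the limit, because `e f(e) -
  -- a = e (f(e) - a) + (e a - a)` and `‖e‖ ≤ 1`.
  have key : ∀ {a : A} {f : A → A}, Tendsto f l (𝓝 a) →
      Tendsto (fun e => e * f e) l (𝓝 a) ∧ Tendsto (fun e => f e * e) l (𝓝 a) := by
    intro a f hf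
    have h5 : Tendsto (fun e => ‖f e - a‖ + ‖e * a - a‖) l (𝓝 0) := by
      simpa using (tendsto_iff_norm_sub_tendsto_zero.1 hf).add
        (tendsto_iff_norm_sub_tendsto_zero.1 (h3 a))
    have h6 : Tendsto (fun e => ‖f e - a‖ + ‖a * e - a‖) l (𝓝 0) := by
      simpa using (tendsto_iff_norm_sub_tendsto_zero.1 hf).add
        (tendsto_iff_norm_sub_tendsto_zero.1 (h4 a))
    constructor
    · refine tendsto_iff_norm_sub_tendsto_zero.2
        (squeeze_zero' (.of_forall fun _ => norm_nonneg _) (h1.mono fun e he => ?_) h5)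
      calc ‖e * f e - a‖ = ‖e * (f e - a) + (e * a - a)‖ := by rw [mul_sub]; congr 1; abel
        _ ≤ 1 * ‖f e - a‖ + ‖e * a - a‖ := (norm_add_le _ _).trans <| by
            gcongr
            exact (norm_mul_le _ _).trans (by gcongr)
        _ = _ := by rw [one_mul]
    · refine tendsto_iff_norm_sub_tendsto_zero.2
        (squeeze_zero' (.of_forall fun _ => norm_nonneg _) (h1.mono fun e he => ?_) h6)
      calc ‖f e * e - a‖ = ‖(f e - a) * e + (a * e - a)‖ := by rw [sub_mul]; congr 1; abel
        _ ≤ ‖f e - a‖ * 1 + ‖a * e - a‖ := (norm_add_le _ _).trans <| by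
            gcongr
            exact (norm_mul_le _ _).trans (by gcongr)
        _ = _ := by rw [mul_one]
  refine ⟨l, h0, h1, h4, fun a => ?_, fun a => ?_, fun a => ?_⟩
  · exact (key (h3 a)).1.congr' (h2.mono fun e he => by simp only [he])
  · exact (key (h4 a)).2.congr' (h2.mono fun e he => by simp only [he])
  · exact (key (h3 a)).2.congr' (h2.mono fun e he => by simp only [he])

end ApproximateUnit

/-! ### Improving lower bounds by repeated squaring -/

section PowerTrick

/-- If `s < r`, then `n (s / r) ^ n` tends to `0` along `n = 2 ^ k`, so the linear factor cannot
compensate for the exponential decay. -/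
theorem le_of_pow_two_pow_le {r s c : ℝ} (hs : 0 ≤ s)
    (h : ∀ k : ℕ, r ^ 2 ^ k ≤ c * 2 ^ k * s ^ 2 ^ k) : r ≤ s := by
  by_contra! hlt
  rcases hs.eq_or_lt with rfl | hs'
  · have := h 0
    norm_num at this
    linarith
  have hr' : 0 < r := hs'.trans hlt
  have hq : 0 < s / r := by positivity
  have hq1 : s / r < 1 := (div_lt_one hr').2 hlt
  have ht : Tendsto (fun k : ℕ => c * (((2 ^ k : ℕ) : ℝ) * (s / r) ^ 2 ^ k)) atTop (𝓝 (c * 0)) :=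
    ((tendsto_self_mul_const_pow_of_lt_one hq.le hq1).comp
      (tendsto_pow_atTop_atTop_of_one_lt one_lt_two)).const_mul c
  rw [mul_zero] at ht
  obtain ⟨k, hk⟩ := (ht.eventually_lt_const zero_lt_one).exists
  have hrk : 0 < r ^ 2 ^ k := by positivity
  have := h k
  rw [div_pow] at hk
  push_cast at hk
  have h2 : c * (2 ^ k * (s ^ 2 ^ k / r ^ 2 ^ k)) = c * 2 ^ k * s ^ 2 ^ k / r ^ 2 ^ k := by ring
  rw [h2, div_lt_one hrk] at hk
  linarith

/-- A `*`-homomorphism that is bounded below on a sequence of sets closed under squaring, with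
constants that do not grow too fast, is bounded below by `1`. -/
theorem norm_le_norm_map_of_growth {D E : Type*} [NonUnitalCStarAlgebra D]
    [NonUnitalCStarAlgebra E] (F : D →⋆ₙₐ[ℂ] E) (Q : ℕ → Set D)
    (hQ : ∀ k, ∀ z ∈ Q k, z * z ∈ Q (k + 1)) (hsa : ∀ k, ∀ z ∈ Q k, IsSelfAdjoint z) (c : ℝ)
    (h : ∀ k, ∀ z ∈ Q k, ‖z‖ ≤ c * 2 ^ k * ‖F z‖) {x : D} (hx : x ∈ Q 0) : ‖x‖ ≤ ‖F x‖ := by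
  have key : ∀ k : ℕ, ∃ z ∈ Q k, ‖z‖ = ‖x‖ ^ 2 ^ k ∧ ‖F z‖ ≤ ‖F x‖ ^ 2 ^ k := by
    intro k
    induction k with
    | zero => exact ⟨x, hx, by simp, by simp⟩
    | succ k ih =>
      obtain ⟨z, hz, h1, h2⟩ := ih
      refine ⟨z * z, hQ k z hz, ?_, ?_⟩
      · have := CStarRing.norm_star_mul_self (x := z)
        rw [(hsa k z hz).star_eq] at this
        rw [this, h1, pow_succ, pow_mul, sq]
      · rw [map_mul, pow_succ, pow_mul, sq]
        exact (norm_mul_le _ _).trans (by gcongr)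
  refine le_of_pow_two_pow_le (c := |c|) (norm_nonneg _) fun k => ?_
  obtain ⟨z, hz, h1, h2⟩ := key k
  rw [← h1]
  refine (h k z hz).trans ?_
  gcongr
  exact le_abs_self c

end PowerTrick

section Span

variable {D : Type w} [NonUnitalCStarAlgebra D]

theorem mul_mem_of_mem_span {s t : Set D} {M : Submodule ℂ D}
    (h : ∀ x ∈ s, ∀ y ∈ t, x * y ∈ M) {x y : D} (hx : x ∈ Submodule.span ℂ s)
    (hy : y ∈ Submodule.span ℂ t) : x * y ∈ M := by
  induction hx using Submodule.span_induction with
  | zero => simp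
  | add x x' _ _ h1 h2 => rw [add_mul]; exact M.add_mem h1 h2
  | smul c x _ h1 => rw [smul_mul_assoc]; exact M.smul_mem c h1
  | mem x hx =>
    induction hy using Submodule.span_induction with
    | zero => simp
    | add y y' _ _ h1 h2 => rw [mul_add]; exact M.add_mem h1 h2
    | smul c y _ h1 => rw [mul_smul_comm]; exact M.smul_mem c h1
    | mem y hy => exact h x hx y hy

theorem star_mem_of_mem_span {s : Set D} {M : Submodule ℂ D} (h : ∀ x ∈ s, star x ∈ M) {x : D}
    (hx : x ∈ Submodule.span ℂ s) : star x ∈ M := by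
  induction hx using Submodule.span_induction with
  | zero => simp
  | add x x' _ _ h1 h2 => rw [star_add]; exact M.add_mem h1 h2
  | smul c x _ h1 => rw [star_smul]; exact M.smul_mem _ h1
  | mem x hx => exact h x hx

end Span

/-! ### Elementary vectors and matrix coefficients -/

section Single

variable {A : Type u} [NonUnitalCStarAlgebra A] {ι : Type*} [DecidableEq ι]

theorem L2.single_apply_same (i : ι) (a : A) : (L2.single i a : L2 ι A) i = a := by
  simp [L2.single]

theorem L2.single_apply_of_ne {i j : ι} (h : j ≠ i) (a : A) : (L2.single i a : L2 ι A) j = 0 := by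
  simp [L2.single, Pi.single_eq_of_ne h]

theorem L2.single_add (i : ι) (a b : A) :
    (L2.single i (a + b) : L2 ι A) = L2.single i a + L2.single i b :=
  Subtype.ext (Pi.single_add (f := fun _ : ι => A) i a b)

theorem L2.single_smul (i : ι) (c : ℂ) (a : A) :
    (L2.single i (c • a) : L2 ι A) = c • L2.single i a :=
  Subtype.ext (Pi.single_smul (f := fun _ : ι => A) i c a)

theorem L2.inner_single (i : ι) (a : A) (x : L2 ι A) : L2.inner (L2.single i a) x = star a * x i := by
  refine (L2.hasSum_inner _ _).unique ?_
  convert hasSum_single i fun j hj => ?_ using 1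
  · simp [L2.single]
  · simp [L2.single, Pi.single_eq_of_ne hj]

theorem L2.norm_single_le (i : ι) (a : A) : ‖(L2.single i a : L2 ι A)‖ ≤ ‖a‖ := by
  rw [L2.norm_def, L2.inner_single]
  simp [L2.single, CStarRing.norm_star_mul_self, Real.sqrt_mul_self (norm_nonneg a)]

/-- The linear map `a ↦ δ_i ⊗ a`. -/
def singleCLM (i : ι) : A →L[ℂ] L2 ι A :=
  LinearMap.mkContinuous
    { toFun := L2.single i
      map_add' := L2.single_add i
      map_smul' := L2.single_smul i } 1 fun a => by
    rw [one_mul]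
    exact L2.norm_single_le i a

/-- The coordinate `ξ ↦ ξ_i`. -/
def coordCLM (i : ι) : L2 ι A →L[ℂ] A :=
  LinearMap.mkContinuous
    { toFun := fun x => x i
      map_add' := fun _ _ => rfl
      map_smul' := fun _ _ => rfl } 1 fun x => by
    rw [one_mul]
    exact L2.norm_apply_le x i

theorem eq_zero_of_forall_star_mul {a : A} (h : ∀ b, star b * a = 0) : a = 0 :=
  CStarRing.star_mul_self_eq_zero_iff a |>.1 (h a)

/-- Row `i` of `T` is determined by the vectors `T⋆(δ_i ⊗ b)`, whose coordinates are adjoint to the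
entries of that row. Passing through the adjoint avoids any density argument for the vectors `δ_j ⊗
c`. -/
theorem Adj.apply_eq_zero {T : Adj ι A} {i : ι} (h : ∀ j c, T.1 (L2.single j c) i = 0)
    (x : L2 ι A) : T.1 x i = 0 := by
  refine eq_zero_of_forall_star_mul fun b => ?_
  have hz : (star T).1 (L2.single i b) = 0 := L2.ext fun j => eq_zero_of_forall_star_mul fun c => by
    rw [← L2.inner_single, ← Adj.inner_apply_left, ← L2.star_inner, L2.inner_single, h, mul_zero,
      star_zero]
  rw [← L2.inner_single, ← L2.star_inner, Adj.inner_apply_left, hz]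
  simp [L2.inner]

end Single

/-- A C*-algebra `D` generated by a copy of `A` and by elements `S_i(a)` which satisfy the
relations of the elements `T_{δ_i ⊗ a}` of the Toeplitz--Pimsner algebra, together with a
`*`-homomorphism to the operators on the full Fock space. -/
structure FockCover {A : Type u} [NonUnitalCStarAlgebra A] (ρ : ℕ → A →⋆ₙₐ[ℂ] A) (D : Type w)
    [NonUnitalCStarAlgebra D] where
  π : A →⋆ₙₐ[ℂ] D
  S : ℕ → A →ₗ[ℂ] D
  F : D →⋆ₙₐ[ℂ] Adj (List ℕ) A
  π_mul_S : ∀ a i b, π a * S i b = S i (ρ i a * b)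
  S_mul_π : ∀ i a b, S i a * π b = S i (a * b)
  star_S_mul_S : ∀ i j a b, star (S i a) * S j b = π (if i = j then star a * b else 0)
  F_π : ∀ a, F (π a) = fockLeft ρ a
  F_S : ∀ i a, F (S i a) = fockShift i * fockLeft ρ a
  dense : (NonUnitalStarAlgebra.adjoin ℂ
    (Set.range π ∪ ⋃ i, Set.range (S i))).topologicalClosure = ⊤

namespace FockCover

variable {A : Type u} [NonUnitalCStarAlgebra A] {ρ : ℕ → A →⋆ₙₐ[ℂ] A} {D : Type w}
  [NonUnitalCStarAlgebra D] (G : FockCover ρ D)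

theorem norm_π_le (a : A) : ‖G.π a‖ ≤ ‖a‖ := NonUnitalStarAlgHom.norm_apply_le G.π a

theorem norm_F_le (x : D) : ‖G.F x‖ ≤ ‖x‖ := NonUnitalStarAlgHom.norm_apply_le G.F x

theorem norm_S_le (i : ℕ) (a : A) : ‖G.S i a‖ ≤ ‖a‖ := by
  refine abs_le_of_sq_le_sq' ?_ (norm_nonneg a) |>.2
  rw [sq, ← CStarRing.norm_star_mul_self, G.star_S_mul_S, if_pos rfl, sq,
    ← CStarRing.norm_star_mul_self]
  exact G.norm_π_le _

theorem continuous_π : Continuous G.π :=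
  AddMonoidHomClass.continuous_of_bound G.π 1 fun a => by
    rw [one_mul]
    exact G.norm_π_le a

theorem continuous_S (i : ℕ) : Continuous (G.S i) :=
  AddMonoidHomClass.continuous_of_bound (G.S i) 1 fun a => by
    rw [one_mul]
    exact G.norm_S_le i a

theorem star_S_mul_π (i : ℕ) (a b : A) :
    star (G.S i a) * G.π b = star (G.S i (ρ i (star b) * a)) := by
  rw [← G.π_mul_S, star_mul, ← map_star G.π, star_star]

/-! ### Words in the generators -/

section Words

variable (N : ℕ)

/-- The products `S_{i_1}(a_1) ⋯ S_{i_p}(a_p) a` with letters `i_1, …, i_p < N`. -/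
def words : ℕ → Set D
  | 0 => Set.range G.π
  | p + 1 => {x | ∃ i < N, ∃ a, ∃ y ∈ words p, x = G.S i a * y}

variable {N}

theorem π_mul_mem_words {p : ℕ} {x : D} (hx : x ∈ G.words N p) (a : A) :
    G.π a * x ∈ G.words N p := by
  cases p with
  | zero =>
    obtain ⟨b, rfl⟩ := hx
    exact ⟨a * b, map_mul _ _ _⟩
  | succ p =>
    obtain ⟨i, hi, b, y, hy, rfl⟩ := hx
    exact ⟨i, hi, ρ i a * b, y, hy, by rw [← mul_assoc, G.π_mul_S]⟩

theorem mul_mem_words {p q : ℕ} {x y : D} (hx : x ∈ G.words N p) (hy : y ∈ G.words N q) :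
    x * y ∈ G.words N (p + q) := by
  induction p generalizing x with
  | zero =>
    obtain ⟨a, rfl⟩ := hx
    rw [zero_add]
    exact G.π_mul_mem_words hy a
  | succ p ih =>
    obtain ⟨i, hi, b, z, hz, rfl⟩ := hx
    rw [Nat.succ_add]
    exact ⟨i, hi, b, z * y, ih hz, mul_assoc _ _ _⟩

/-- Letters cancel in pairs: `S_i(a)⋆ S_j(b)` lies in `A` and is absorbed by the next factor. This
reduces every product of terms `u v⋆` to the same form. -/
theorem star_mul_mem_words {p q : ℕ} {x y : D} (hx : x ∈ G.words N p)
    (hy : y ∈ G.words N (p + q)) : star x * y ∈ G.words N q := by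
  induction p generalizing x y with
  | zero =>
    obtain ⟨a, rfl⟩ := hx
    rw [zero_add] at hy
    rw [← map_star]
    exact G.π_mul_mem_words hy _
  | succ p ih =>
    rw [Nat.succ_add] at hy
    obtain ⟨i, hi, a, z, hz, rfl⟩ := hx
    obtain ⟨j, hj, b, z', hz', rfl⟩ := hy
    have : star (G.S i a * z) * (G.S j b * z') =
        star z * (G.π (if i = j then star a * b else 0) * z') := by
      rw [← G.star_S_mul_S, star_mul]
      simp only [mul_assoc]
    rw [this]
    exact ih hz (G.π_mul_mem_words hz' _)

theorem words_mono {N M : ℕ} (h : N ≤ M) (p : ℕ) : G.words N p ⊆ G.words M p := by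
  induction p with
  | zero => exact subset_rfl
  | succ p ih =>
    rintro _ ⟨i, hi, a, y, hy, rfl⟩
    exact ⟨i, hi.trans_le h, a, y, ih hy, rfl⟩

end Words

section Fock

theorem F_S_mul_apply_nil (i : ℕ) (a : A) (x : D) (ξ : L2 (List ℕ) A) :
    (G.F (G.S i a * x)).1 ξ [] = 0 := by
  rw [map_mul, G.F_S, Adj.mul_apply, Adj.mul_apply]
  exact shift_apply' (List.cons i) List.cons_injective _ _ (by simp)

theorem F_star_S_apply_single_nil (i : ℕ) (a c : A) :
    (G.F (star (G.S i a))).1 (L2.single [] c) = 0 := by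
  rw [map_star, G.F_S, star_mul, Adj.mul_apply]
  have : (star (fockShift i)).1 (L2.single [] c) = 0 := L2.ext fun w => by
    rw [fockShift, star_shift_apply]
    simp [L2.single]
  rw [this, map_zero]

theorem F_π_apply_nil (a : A) (ξ : L2 (List ℕ) A) : (G.F (G.π a)).1 ξ [] = a * ξ [] := by
  rw [G.F_π]
  rfl

/-- Testing on `c = a⋆` gives `‖a‖ ^ 2 = ‖a a⋆‖ ≤ ‖x‖ ‖a‖`. -/
theorem norm_le_of_vacuum {x : Adj (List ℕ) A} {a : A}
    (h : ∀ c, x.1 (L2.single [] c) [] = a * c) : ‖a‖ ≤ ‖x‖ := by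
  have h1 : ‖a‖ * ‖a‖ ≤ ‖x‖ * ‖a‖ := by
    rw [← CStarRing.norm_self_mul_star, ← h]
    refine (L2.norm_apply_le _ _).trans ((ContinuousLinearMap.le_opNorm x.1 _).trans ?_)
    refine mul_le_mul_of_nonneg_left ((L2.norm_single_le _ _).trans (norm_star a).le) (norm_nonneg _)
  by_contra! hlt
  nlinarith [norm_nonneg x]

end Fock

end FockCover

namespace FockCover

variable {A : Type u} [NonUnitalCStarAlgebra A] {ρ : ℕ → A →⋆ₙₐ[ℂ] A} {D : Type w}
  [NonUnitalCStarAlgebra D] (G : FockCover ρ D)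

/-! ### The gauge degree zero part: `F` is isometric on it -/

section Core

variable (N : ℕ)

/-- The part of degree zero of the Toeplitz algebra, for words of length at most `n` in letters
less than `N`. -/
def core : ℕ → Submodule ℂ D
  | 0 => Submodule.span ℂ (Set.range G.π)
  | n + 1 => Submodule.span ℂ (Set.range G.π ∪
      {x | ∃ i < N, ∃ j < N, ∃ a b, ∃ y ∈ core n, x = G.S i a * y * star (G.S j b)})

/-- The elements of the core without component in `A`. -/
def corePart (n : ℕ) : Submodule ℂ D :=
  Submodule.span ℂ
    {x | ∃ i < N, ∃ j < N, ∃ a b, ∃ y ∈ G.core N n, x = G.S i a * y * star (G.S j b)}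

variable {N}

theorem exists_of_mem_span_range_π {x : D} (hx : x ∈ Submodule.span ℂ (Set.range G.π)) :
    ∃ a, x = G.π a := by
  induction hx using Submodule.span_induction with
  | zero => exact ⟨0, (map_zero _).symm⟩
  | add x y _ _ h1 h2 =>
    obtain ⟨a, rfl⟩ := h1
    obtain ⟨b, rfl⟩ := h2
    exact ⟨a + b, (map_add _ _ _).symm⟩
  | smul c x _ h =>
    obtain ⟨a, rfl⟩ := h
    exact ⟨c • a, (map_smul _ _ _).symm⟩
  | mem x h =>
    obtain ⟨a, rfl⟩ := h
    exact ⟨a, rfl⟩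

theorem exists_of_mem_core_succ {n : ℕ} {x : D} (hx : x ∈ G.core N (n + 1)) :
    ∃ a, ∃ y ∈ G.corePart N n, x = G.π a + y := by
  rw [core, Submodule.span_union, Submodule.mem_sup] at hx
  obtain ⟨y, hy, z, hz, rfl⟩ := hx
  obtain ⟨a, rfl⟩ := G.exists_of_mem_span_range_π hy
  exact ⟨a, z, hz, rfl⟩

theorem π_mem_core (n : ℕ) (a : A) : G.π a ∈ G.core N n := by
  cases n with
  | zero => exact Submodule.subset_span ⟨a, rfl⟩
  | succ n => exact Submodule.subset_span (Or.inl ⟨a, rfl⟩)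

theorem S_mul_mul_star_S_mem_core {n i j : ℕ} (hi : i < N) (hj : j < N) (a b : A) {x : D}
    (hx : x ∈ G.core N n) : G.S i a * x * star (G.S j b) ∈ G.core N (n + 1) :=
  Submodule.subset_span (Or.inr ⟨i, hi, j, hj, a, b, x, hx, rfl⟩)

theorem mul_mem_core {n : ℕ} {x y : D} (hx : x ∈ G.core N n) (hy : y ∈ G.core N n) :
    x * y ∈ G.core N n := by
  induction n generalizing x y with
  | zero =>
    refine mul_mem_of_mem_span ?_ hx hy
    rintro _ ⟨a, rfl⟩ _ ⟨b, rfl⟩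
    rw [← map_mul]
    exact G.π_mem_core 0 _
  | succ n ih =>
    refine mul_mem_of_mem_span ?_ hx hy
    rintro _ (⟨a, rfl⟩ | ⟨i, hi, j, hj, a, b, x, hx, rfl⟩) _
      (⟨a', rfl⟩ | ⟨i', hi', j', hj', a', b', y, hy, rfl⟩)
    · rw [← map_mul]
      exact G.π_mem_core _ _
    · rw [← mul_assoc, ← mul_assoc, G.π_mul_S]
      exact G.S_mul_mul_star_S_mem_core hi' hj' _ _ hy
    · rw [mul_assoc, G.star_S_mul_π]
      exact G.S_mul_mul_star_S_mem_core hi hj _ _ hx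
    · have : G.S i a * x * star (G.S j b) * (G.S i' a' * y * star (G.S j' b')) =
          G.S i a * (x * G.π (if j = i' then star b * a' else 0) * y) * star (G.S j' b') := by
        rw [← G.star_S_mul_S]
        simp only [mul_assoc]
      rw [this]
      exact G.S_mul_mul_star_S_mem_core hi hj' _ _ (ih (ih hx (G.π_mem_core _ _)) hy)

theorem star_mem_core {n : ℕ} {x : D} (hx : x ∈ G.core N n) : star x ∈ G.core N n := by
  induction n generalizing x with
  | zero =>
    refine star_mem_of_mem_span ?_ hx
    rintro _ ⟨a, rfl⟩
    rw [← map_star]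
    exact G.π_mem_core 0 _
  | succ n ih =>
    refine star_mem_of_mem_span ?_ hx
    rintro _ (⟨a, rfl⟩ | ⟨i, hi, j, hj, a, b, x, hx, rfl⟩)
    · rw [← map_star]
      exact G.π_mem_core _ _
    · rw [star_mul, star_mul, star_star, ← mul_assoc]
      exact G.S_mul_mul_star_S_mem_core hj hi _ _ (ih hx)

theorem core_le_succ (n : ℕ) : G.core N n ≤ G.core N (n + 1) := by
  induction n with
  | zero => exact Submodule.span_mono Set.subset_union_left
  | succ n ih =>
    refine Submodule.span_mono (Set.union_subset_union_right _ ?_)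
    rintro _ ⟨i, hi, j, hj, a, b, x, hx, rfl⟩
    exact ⟨i, hi, j, hj, a, b, x, ih hx, rfl⟩

theorem core_mono : Monotone (G.core N) := monotone_nat_of_le_succ G.core_le_succ

theorem mul_star_mem_core {p : ℕ} {x y : D} (hx : x ∈ G.words N p) (hy : y ∈ G.words N p) :
    x * star y ∈ G.core N p := by
  induction p generalizing x y with
  | zero =>
    obtain ⟨a, rfl⟩ := hx
    obtain ⟨b, rfl⟩ := hy
    rw [← map_star, ← map_mul]
    exact G.π_mem_core 0 _
  | succ p ih =>
    obtain ⟨i, hi, a, z, hz, rfl⟩ := hx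
    obtain ⟨j, hj, b, z', hz', rfl⟩ := hy
    rw [star_mul, ← mul_assoc, mul_assoc (G.S i a)]
    exact G.S_mul_mul_star_S_mem_core hi hj _ _ (ih hz hz')

/-- Compression strips one letter on each side; this is what lets an estimate for words of length
`n` be used for length `n + 1`. -/
theorem star_S_mul_mul_S_mem_core {n : ℕ} {y : D} (hy : y ∈ G.corePart N n) (i j : ℕ) (a b : A) :
    star (G.S i a) * y * G.S j b ∈ G.core N n := by
  induction hy using Submodule.span_induction with
  | zero => simp
  | add y z _ _ h1 h2 => rw [mul_add, add_mul]; exact Submodule.add_mem _ h1 h2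
  | smul c y _ h =>
    rw [mul_smul_comm, smul_mul_assoc]
    exact Submodule.smul_mem _ _ h
  | mem y hy =>
    obtain ⟨i', -, j', -, a', b', y, hy, rfl⟩ := hy
    have : star (G.S i a) * (G.S i' a' * y * star (G.S j' b')) * G.S j b =
        G.π (if i = i' then star a * a' else 0) * y *
          G.π (if j' = j then star b' * b else 0) := by
      rw [← G.star_S_mul_S, ← G.star_S_mul_S]
      simp only [mul_assoc]
    rw [this]
    exact G.mul_mem_core (G.mul_mem_core (G.π_mem_core _ _) hy) (G.π_mem_core _ _)

theorem F_corePart_apply_nil {n : ℕ} {y : D} (hy : y ∈ G.corePart N n) (ξ : L2 (List ℕ) A) :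
    (G.F y).1 ξ [] = 0 := by
  induction hy using Submodule.span_induction with
  | zero => rw [map_zero]; rfl
  | add y z _ _ h1 h2 => rw [map_add, Adj.add_apply, L2.add_apply, h1, h2, add_zero]
  | smul c y _ h => rw [map_smul, Adj.smul_apply, L2.smul_apply, h, smul_zero]
  | mem y hy =>
    obtain ⟨i, -, j, -, a, b, y, -, rfl⟩ := hy
    rw [mul_assoc]
    exact G.F_S_mul_apply_nil _ _ _ _

variable (N) in
/-- The approximate projection onto the vectors that start with a letter less than `N`. -/
def letterProj (e : A) : D := ∑ i ∈ Finset.range N, G.S i e * star (G.S i e)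

theorem letterProj_mul_S {i : ℕ} (hi : i < N) (e a : A) :
    G.letterProj N e * G.S i a = G.S i (e * (star e * a)) := by
  rw [letterProj, Finset.sum_mul, Finset.sum_eq_single i]
  · rw [mul_assoc, G.star_S_mul_S, if_pos rfl, G.S_mul_π]
  · intro j _ hj
    rw [mul_assoc, G.star_S_mul_S, if_neg hj, map_zero, mul_zero]
  · intro h
    exact absurd (Finset.mem_range.2 hi) h

theorem star_S_mul_letterProj {i : ℕ} (hi : i < N) (e a : A) :
    star (G.S i a) * G.letterProj N e = star (G.S i (e * (star e * a))) := by
  have : star (G.letterProj N e) = G.letterProj N e := by simp [letterProj, star_sum]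
  rw [← G.letterProj_mul_S hi, star_mul, this]

/-- On an outer factor, `letterProj` turns `S_i(a)` into `S_i(e e⋆ a)`, which tends to `S_i(a)`. -/
theorem tendsto_letterProj {l : Filter A} (hl : ∀ a, Tendsto (fun e => e * (star e * a)) l (𝓝 a))
    {n : ℕ} {y : D} (hy : y ∈ G.corePart N n) :
    Tendsto (fun e => G.letterProj N e * y * G.letterProj N e) l (𝓝 y) := by
  induction hy using Submodule.span_induction with
  | zero => simpa using tendsto_const_nhds
  | add y z _ _ h1 h2 => simpa only [mul_add, add_mul] using h1.add h2
  | smul c y _ h => simpa only [mul_smul_comm, smul_mul_assoc] using h.const_smul c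
  | mem y hy =>
    obtain ⟨i, hi, j, hj, a, b, y, -, rfl⟩ := hy
    have : ∀ e, G.letterProj N e * (G.S i a * y * star (G.S j b)) * G.letterProj N e =
        G.S i (e * (star e * a)) * y * star (G.S j (e * (star e * b))) := fun e => by
      rw [← G.letterProj_mul_S hi, ← G.star_S_mul_letterProj hj]
      simp only [mul_assoc]
    simp only [this]
    exact ((((G.continuous_S i).tendsto a).comp (hl a)).mul_const y).mul
      (((G.continuous_S j).tendsto b).comp (hl b)).star

/-- In the limit over `e`, `y` is the sum of the `N ^ 2` terms `S_i(e) (S_i(e)⋆ y S_j(e)) S_j(e)⋆`.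
The compression in the middle lies in `core N n`, where the constant `K` is available. -/
theorem norm_le_of_core_bound {n : ℕ} {K : ℝ} (hK : 0 ≤ K)
    (h : ∀ x ∈ G.core N n, ‖x‖ ≤ K * ‖G.F x‖) {y : D} (hy : y ∈ G.corePart N n) :
    ‖y‖ ≤ N * N * K * ‖G.F y‖ := by
  obtain ⟨l, hl, h1, -, h2, -⟩ := exists_approximateUnit A
  refine le_of_tendsto (G.tendsto_letterProj h2 hy).norm (h1.mono fun e he => ?_)
  have hS : ∀ i, ‖G.S i e‖ ≤ 1 := fun i => (G.norm_S_le i e).trans he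
  have key : ∀ i j, ‖G.S i e * star (G.S i e) * y * (G.S j e * star (G.S j e))‖ ≤
      K * ‖G.F y‖ := fun i j => by
    have e1 : G.S i e * star (G.S i e) * y * (G.S j e * star (G.S j e)) =
        G.S i e * (star (G.S i e) * y * G.S j e) * star (G.S j e) := by
      simp only [mul_assoc]
    calc _ ≤ ‖G.S i e‖ * ‖star (G.S i e) * y * G.S j e‖ * ‖star (G.S j e)‖ := by
          rw [e1]
          exact (norm_mul_le _ _).trans (by gcongr; exact norm_mul_le _ _)
      _ ≤ 1 * ‖star (G.S i e) * y * G.S j e‖ * 1 := by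
          gcongr
          · exact hS i
          · rw [norm_star]
            exact hS j
      _ ≤ K * ‖G.F (star (G.S i e) * y * G.S j e)‖ := by
          rw [one_mul, mul_one]
          exact h _ (G.star_S_mul_mul_S_mem_core hy i j e e)
      _ ≤ K * (1 * ‖G.F y‖ * 1) := by
          gcongr
          rw [map_mul, map_mul]
          refine (norm_mul_le _ _).trans ?_
          gcongr
          · refine (norm_mul_le _ _).trans ?_
            gcongr
            exact (G.norm_F_le _).trans ((norm_star _).trans_le (hS i))
          · exact (G.norm_F_le _).trans (hS j)
      _ = _ := by ring
  rw [letterProj, Finset.sum_mul, Finset.sum_mul]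
  simp only [Finset.mul_sum]
  calc _ ≤ ∑ i ∈ Finset.range N, ∑ j ∈ Finset.range N, K * ‖G.F y‖ :=
        (norm_sum_le _ _).trans (Finset.sum_le_sum fun i _ =>
          (norm_sum_le _ _).trans (Finset.sum_le_sum fun j _ => key i j))
    _ = _ := by
        simp only [Finset.sum_const, Finset.card_range, nsmul_eq_mul]
        ring

/-- Write `x = a + y` with `y` without component in `A`. The vacuum corner gives `‖a‖ ≤ ‖F x‖`,
hence `‖F y‖ ≤ 2 ‖F x‖`, and `y` is handled by the bound for shorter words. The dependence of the
constant on `N` and `n` is harmless. -/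
theorem exists_core_bound (n : ℕ) :
    ∃ K : ℝ, 0 ≤ K ∧ ∀ x ∈ G.core N n, ‖x‖ ≤ K * ‖G.F x‖ := by
  induction n with
  | zero =>
    refine ⟨1, zero_le_one, fun x hx => ?_⟩
    obtain ⟨a, rfl⟩ := G.exists_of_mem_span_range_π hx
    rw [one_mul]
    refine (G.norm_π_le a).trans (norm_le_of_vacuum fun c => ?_)
    rw [G.F_π_apply_nil, L2.single_apply_same]
  | succ n ih =>
    obtain ⟨K, hK, ih⟩ := ih
    refine ⟨1 + N * N * K * 2, by positivity, fun x hx => ?_⟩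
    obtain ⟨a, y, hy, rfl⟩ := G.exists_of_mem_core_succ hx
    have h1 : ‖a‖ ≤ ‖G.F (G.π a + y)‖ := norm_le_of_vacuum fun c => by
      rw [map_add, Adj.add_apply, L2.add_apply, G.F_corePart_apply_nil hy, G.F_π_apply_nil,
        L2.single_apply_same, add_zero]
    have h2 : ‖G.F y‖ ≤ 2 * ‖G.F (G.π a + y)‖ := by
      calc _ = ‖G.F (G.π a + y) - G.F (G.π a)‖ := by rw [← map_sub, add_sub_cancel_left]
        _ ≤ ‖G.F (G.π a + y)‖ + ‖a‖ := (norm_sub_le _ _).trans <| by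
            gcongr
            exact (G.norm_F_le _).trans (G.norm_π_le a)
        _ ≤ _ := by linarith
    calc _ ≤ ‖a‖ + N * N * K * ‖G.F y‖ := (norm_add_le _ _).trans
          (add_le_add (G.norm_π_le a) (G.norm_le_of_core_bound hK ih hy))
      _ ≤ ‖G.F (G.π a + y)‖ + N * N * K * (2 * ‖G.F (G.π a + y)‖) := by gcongr
      _ = _ := by ring

/-- For fixed `N` and `n` the core is closed under products and adjoints, so one constant serves all
powers of `x⋆ x`, and squaring improves it to `1`. -/
theorem norm_le_norm_F_of_mem_core {n : ℕ} {x : D} (hx : x ∈ G.core N n) : ‖x‖ ≤ ‖G.F x‖ := by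
  obtain ⟨K, hK, h⟩ := G.exists_core_bound (N := N) n
  have key : ‖star x * x‖ ≤ ‖G.F (star x * x)‖ :=
    norm_le_norm_map_of_growth G.F (fun _ => {z | z ∈ G.core N n ∧ IsSelfAdjoint z})
      (fun _ z hz => ⟨G.mul_mem_core hz.1 hz.1, by
        rw [isSelfAdjoint_iff, star_mul, hz.2.star_eq]⟩)
      (fun _ z hz => hz.2) K (fun k z hz => (h z hz.1).trans <| by
        gcongr
        exact le_mul_of_one_le_right hK (one_le_pow₀ one_le_two))
      ⟨G.mul_mem_core (G.star_mem_core hx) hx, IsSelfAdjoint.star_mul_self x⟩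
  rw [map_mul, map_star, CStarRing.norm_star_mul_self, CStarRing.norm_star_mul_self] at key
  by_contra! hlt
  nlinarith [norm_nonneg (G.F x)]

end Core

end FockCover

/-! ### Gauge unitaries on the Fock space -/

section Gauge

variable {A : Type u} [NonUnitalCStarAlgebra A]

theorem star_circle_smul_mul (z : Circle) (n : ℕ) (a b : A) :
    star ((z : ℂ) ^ n • a) * ((z : ℂ) ^ n • b) = star a * b := by
  rw [star_smul, smul_mul_smul_comm, star_pow, ← mul_pow]
  have : star (z : ℂ) * z = 1 := by
    rw [Complex.star_def, ← Complex.normSq_eq_conj_mul_self, Circle.normSq_coe, Complex.ofReal_one]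
  rw [this, one_pow, one_smul]

/-- The linear map `δ_𝔫 ⊗ a ↦ z ^ |𝔫| δ_𝔫 ⊗ a` on the full Fock space. -/
def gaugeLin (z : Circle) : L2 (List ℕ) A →ₗ[ℂ] L2 (List ℕ) A where
  toFun x := ⟨fun w => (z : ℂ) ^ w.length • x w,
    x.summable.congr fun _ => (star_circle_smul_mul z _ _ _).symm⟩
  map_add' _ _ := L2.ext fun _ => smul_add _ _ _
  map_smul' _ _ := L2.ext fun _ => smul_comm _ _ _

@[simp] theorem gaugeLin_apply (z : Circle) (x : L2 (List ℕ) A) (w : List ℕ) :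
    gaugeLin z x w = (z : ℂ) ^ w.length • x w := rfl

theorem gaugeLin_inv (z : Circle) (x : L2 (List ℕ) A) : gaugeLin z (gaugeLin z⁻¹ x) = x :=
  L2.ext fun w => by
    rw [gaugeLin_apply, gaugeLin_apply, smul_smul, ← mul_pow, ← Circle.coe_mul, mul_inv_cancel,
      Circle.coe_one, one_pow, one_smul]

theorem inner_gaugeLin (z : Circle) (x y : L2 (List ℕ) A) :
    L2.inner (gaugeLin z x) (gaugeLin z y) = L2.inner x y := by
  simp only [L2.inner, gaugeLin_apply, star_circle_smul_mul]

theorem norm_gaugeLin_le (z : Circle) (x : L2 (List ℕ) A) : ‖gaugeLin z x‖ ≤ 1 * ‖x‖ := by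
  rw [L2.norm_def, inner_gaugeLin, one_mul, L2.norm_def]

variable (A) in
/-- The gauge unitaries on the full Fock space. -/
def gauge (z : Circle) : Adj (List ℕ) A :=
  Adj.ofPair (gaugeLin z) (gaugeLin z⁻¹) 1 1 (norm_gaugeLin_le z) (norm_gaugeLin_le z⁻¹)
    fun x y => by rw [← inner_gaugeLin z x, gaugeLin_inv]

theorem star_gauge (z : Circle) : star (gauge A z) = gauge A z⁻¹ :=
  (Adj.eq_star fun x y => by
    change L2.inner (gaugeLin z x) y = L2.inner x (gaugeLin z⁻¹ y)
    rw [← inner_gaugeLin z x, gaugeLin_inv]).symm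

theorem gauge_mul_inv (z : Circle) : gauge A z * gauge A z⁻¹ = 1 :=
  Adj.ext fun x => gaugeLin_inv z x

theorem norm_gauge_le (z : Circle) : ‖gauge A z‖ ≤ 1 :=
  ContinuousLinearMap.opNorm_le_bound _ zero_le_one (norm_gaugeLin_le z)

theorem gauge_mul_fockLeft (ρ : ℕ → A →⋆ₙₐ[ℂ] A) (z : Circle) (a : A) :
    gauge A z * fockLeft ρ a = fockLeft ρ a * gauge A z :=
  Adj.ext fun x => L2.ext fun w =>
    (mul_smul_comm ((z : ℂ) ^ w.length) (wordEnd ρ w a) (x w)).symm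

theorem gauge_mul_fockShift (z : Circle) (i : ℕ) :
    gauge A z * fockShift i = (z : ℂ) • (fockShift i * gauge A z) := by
  refine Adj.ext fun x => L2.ext fun w => ?_
  change (z : ℂ) ^ w.length • (fockShift i).1 x w = (z : ℂ) • (fockShift i).1 (gaugeLin z x) w
  by_cases h : ∃ v, i :: v = w
  · obtain ⟨v, rfl⟩ := h
    rw [fockShift, shift_apply (List.cons i) List.cons_injective x v,
      shift_apply (List.cons i) List.cons_injective _ v, gaugeLin_apply, smul_smul,
      List.length_cons, pow_succ']
  · rw [fockShift, shift_apply' _ _ _ _ h, shift_apply' _ _ _ _ h, smul_zero, smul_zero]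

end Gauge

namespace FockCover

variable {A : Type u} [NonUnitalCStarAlgebra A] {ρ : ℕ → A →⋆ₙₐ[ℂ] A} {D : Type w}
  [NonUnitalCStarAlgebra D] (G : FockCover ρ D)

section Gauge

variable {N : ℕ}

theorem gauge_mul_F_words (z : Circle) {p : ℕ} {x : D} (hx : x ∈ G.words N p) :
    gauge A z * G.F x = (z : ℂ) ^ p • (G.F x * gauge A z) := by
  induction p generalizing x with
  | zero =>
    obtain ⟨a, rfl⟩ := hx
    rw [G.F_π, gauge_mul_fockLeft, pow_zero, one_smul]
  | succ p ih =>
    obtain ⟨i, -, a, y, hy, rfl⟩ := hx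
    rw [map_mul, G.F_S, ← mul_assoc, ← mul_assoc, gauge_mul_fockShift, smul_mul_assoc,
      smul_mul_assoc, mul_assoc (fockShift i), gauge_mul_fockLeft, mul_assoc (fockShift i),
      mul_assoc (fockLeft ρ a), ih hy, mul_smul_comm, mul_smul_comm, smul_smul, ← pow_succ']
    simp only [mul_assoc]

theorem F_star_words_mul_gauge (z : Circle) {p : ℕ} {x : D} (hx : x ∈ G.words N p) :
    G.F (star x) * gauge A z⁻¹ = ((z : ℂ)⁻¹) ^ p • (gauge A z⁻¹ * G.F (star x)) := by
  have h := congr_arg star (G.gauge_mul_F_words z hx)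
  rw [star_mul, star_smul, star_mul, star_gauge, ← map_star, star_pow] at h
  rw [h, Complex.star_def, ← Circle.coe_inv_eq_conj, Circle.coe_inv]

end Gauge

/-! ### Polynomials in the generators and faithfulness of `F` -/

section Polynomials

variable (N d : ℕ)

/-- The polynomials of degree at most `d` in the generators with index less than `N`. -/
def polys : Submodule ℂ D :=
  Submodule.span ℂ {x | ∃ p ≤ d, ∃ q ≤ d, ∃ u ∈ G.words N p, ∃ v ∈ G.words N q, x = u * star v}

/-- The homogeneous polynomials of degree `k` for the gauge action. -/
def homogPolys (k : ℤ) : Submodule ℂ D :=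
  Submodule.span ℂ {x | ∃ p ≤ d, ∃ q ≤ d, (p : ℤ) - q = k ∧
    ∃ u ∈ G.words N p, ∃ v ∈ G.words N q, x = u * star v}

variable {N d}

theorem star_mem_polys {x : D} (hx : x ∈ G.polys N d) : star x ∈ G.polys N d := by
  refine star_mem_of_mem_span ?_ hx
  rintro _ ⟨p, hp, q, hq, u, hu, v, hv, rfl⟩
  rw [star_mul, star_star]
  exact Submodule.subset_span ⟨q, hq, p, hp, v, hv, u, hu, rfl⟩

theorem polys_mono {N M d e : ℕ} (h : N ≤ M) (h' : d ≤ e) : G.polys N d ≤ G.polys M e := by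
  refine Submodule.span_mono ?_
  rintro _ ⟨p, hp, q, hq, u, hu, v, hv, rfl⟩
  exact ⟨p, hp.trans h', q, hq.trans h', u, G.words_mono h _ hu, v, G.words_mono h _ hv, rfl⟩

/-- In `u v⋆ u' v'⋆` the inner factor `v⋆ u'` reduces to a word or to the adjoint of a word.
Squaring thus at most doubles the degree, the growth that `norm_le_norm_map_of_growth` allows. -/
theorem mul_mem_polys {x y : D} (hx : x ∈ G.polys N d) (hy : y ∈ G.polys N d) :
    x * y ∈ G.polys N (2 * d) := by
  refine mul_mem_of_mem_span ?_ hx hy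
  rintro _ ⟨p, hp, q, hq, u, hu, v, hv, rfl⟩ _ ⟨p', hp', q', hq', u', hu', v', hv', rfl⟩
  rcases le_total q p' with h | h
  · obtain ⟨r, rfl⟩ := Nat.exists_eq_add_of_le h
    refine Submodule.subset_span ⟨p + r, by lia, q', by lia, u * (star v * u'),
      G.mul_mem_words hu (G.star_mul_mem_words hv hu'), v', hv', ?_⟩
    simp only [mul_assoc]
  · obtain ⟨r, rfl⟩ := Nat.exists_eq_add_of_le h
    refine Submodule.subset_span ⟨p, by lia, q' + r, by lia, u, hu, v' * (star u' * v),
      G.mul_mem_words hv' (G.star_mul_mem_words hu' hv), ?_⟩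
    simp only [star_mul, star_star, mul_assoc]

theorem star_mem_homogPolys {k : ℤ} {x : D} (hx : x ∈ G.homogPolys N d k) :
    star x ∈ G.homogPolys N d (-k) := by
  refine star_mem_of_mem_span ?_ hx
  rintro _ ⟨p, hp, q, hq, hk, u, hu, v, hv, rfl⟩
  rw [star_mul, star_star]
  exact Submodule.subset_span ⟨q, hq, p, hp, by lia, v, hv, u, hu, rfl⟩

theorem mul_mem_core_of_homogPolys {k : ℤ} {x y : D} (hx : x ∈ G.homogPolys N d (-k))
    (hy : y ∈ G.homogPolys N d k) : x * y ∈ G.core N d := by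
  refine mul_mem_of_mem_span ?_ hx hy
  rintro _ ⟨p, hp, q, hq, h1, u, hu, v, hv, rfl⟩ _ ⟨p', hp', q', hq', h2, u', hu', v', hv', rfl⟩
  rcases le_total q p' with h | h
  · obtain ⟨r, rfl⟩ := Nat.exists_eq_add_of_le h
    -- The degrees `-k` and `k` cancel, so the two words of the reduced product have the same
    -- length. This length is one of the original ones, so the bound stays `d`.
    obtain rfl : q' = p + r := by lia
    have := G.mul_star_mem_core (G.mul_mem_words hu (G.star_mul_mem_words hv hu')) hv'
    simp only [mul_assoc] at this ⊢
    exact G.core_mono hq' this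
  · obtain ⟨r, rfl⟩ := Nat.exists_eq_add_of_le h
    obtain rfl : p = q' + r := by lia
    have := G.mul_star_mem_core hu (G.mul_mem_words hv' (G.star_mul_mem_words hu' hv))
    simp only [star_mul, star_star, mul_assoc] at this ⊢
    exact G.core_mono hp this

/-- Since `x⋆ x` has degree zero, the core estimate and the C*-identity apply. -/
theorem norm_le_norm_F_of_mem_homogPolys {k : ℤ} {x : D} (hx : x ∈ G.homogPolys N d k) :
    ‖x‖ ≤ ‖G.F x‖ := by
  have key := G.norm_le_norm_F_of_mem_core
    (G.mul_mem_core_of_homogPolys (G.star_mem_homogPolys hx) hx)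
  rw [map_mul, map_star, CStarRing.norm_star_mul_self, CStarRing.norm_star_mul_self] at key
  by_contra! hlt
  nlinarith [norm_nonneg (G.F x)]

theorem exists_homogeneous_decomposition {x : D} (hx : x ∈ G.polys N d) :
    ∃ f : ℤ → D, (∀ k, f k ∈ G.homogPolys N d k) ∧
      x = ∑ k ∈ Finset.Icc (-d : ℤ) d, f k := by
  induction hx using Submodule.span_induction with
  | zero => exact ⟨0, fun k => Submodule.zero_mem _, by simp⟩
  | add x y _ _ h1 h2 =>
    obtain ⟨f, hf, rfl⟩ := h1
    obtain ⟨g, hg, rfl⟩ := h2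
    exact ⟨f + g, fun k => Submodule.add_mem _ (hf k) (hg k), by
      simp [Finset.sum_add_distrib]⟩
  | smul c x _ h =>
    obtain ⟨f, hf, rfl⟩ := h
    exact ⟨c • f, fun k => Submodule.smul_mem _ c (hf k), by simp [Finset.smul_sum]⟩
  | mem x hx =>
    obtain ⟨p, hp, q, hq, u, hu, v, hv, rfl⟩ := hx
    refine ⟨Pi.single ((p : ℤ) - q) (u * star v), fun k => ?_, ?_⟩
    · by_cases h : k = p - q
      · subst h
        rw [Pi.single_eq_same]
        exact Submodule.subset_span ⟨p, hp, q, hq, rfl, u, hu, v, hv, rfl⟩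
      · rw [Pi.single_eq_of_ne h]
        exact Submodule.zero_mem _
    · rw [Finset.sum_pi_single', if_pos (Finset.mem_Icc.2 (by lia))]

/-- The unitaries act on the Fock space, so degrees are separated after applying `F` and no gauge
action on `D` is needed. -/
theorem gauge_conj_F (z : Circle) {k : ℤ} {x : D} (hx : x ∈ G.homogPolys N d k) :
    gauge A z * G.F x * gauge A z⁻¹ = (z : ℂ) ^ k • G.F x := by
  induction hx using Submodule.span_induction with
  | zero => simp
  | add x y _ _ h1 h2 => rw [map_add, mul_add, add_mul, h1, h2, smul_add]
  | smul c x _ h => rw [map_smul, mul_smul_comm, smul_mul_assoc, h, smul_comm]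
  | mem x hx =>
    obtain ⟨p, -, q, -, rfl, u, hu, v, hv, rfl⟩ := hx
    rw [map_mul, ← mul_assoc, G.gauge_mul_F_words z hu, mul_assoc, G.F_star_words_mul_gauge z hv,
      smul_mul_smul_comm, mul_assoc, ← mul_assoc (gauge A z), gauge_mul_inv, one_mul,
      inv_pow, zpow_sub₀ (Circle.coe_ne_zero z), zpow_natCast, zpow_natCast, div_eq_mul_inv]

/-- A homogeneous component is a Fourier coefficient of the gauge orbit of `X`. As only finitely
many degrees occur, it is a finite average over roots of unity of unimodular multiples of conjugates
of `X`. -/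
theorem norm_F_homogeneous_le {f : ℤ → D} (hf : ∀ k, f k ∈ G.homogPolys N d k) {k : ℤ}
    (hk : k ∈ Finset.Icc (-d : ℤ) d) :
    ‖G.F (f k)‖ ≤ ‖G.F (∑ l ∈ Finset.Icc (-d : ℤ) d, f l)‖ := by
  -- Two degrees in `[-d, d]` differ by at most `2 d < m`, so distinct degrees are distinct modulo
  -- `m` and an `m`-th root of unity separates them.
  set m : ℕ := 2 * d + 1 with hm
  set X := G.F (∑ l ∈ Finset.Icc (-d : ℤ) d, f l) with hX
  let z : Circle := Circle.exp (2 * Real.pi / m)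
  have hz : IsPrimitiveRoot (z : ℂ) m := by
    convert Complex.isPrimitiveRoot_exp m (by lia) using 1
    rw [Circle.coe_exp]
    congr 1
    push_cast
    ring
  have hz0 : (z : ℂ) ≠ 0 := Circle.coe_ne_zero z
  have hsum : ∀ l ∈ Finset.Icc (-d : ℤ) d,
      ∑ j ∈ Finset.range m, ((z : ℂ) ^ (l - k)) ^ j = if l = k then (m : ℂ) else 0 := by
    intro l hl
    split_ifs with h
    · simp [h]
    · rw [Finset.mem_Icc] at hl hk
      have h1 : (z : ℂ) ^ (l - k) ≠ 1 := fun h1 => by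
        have := Int.eq_zero_of_abs_lt_dvd ((hz.zpow_eq_one_iff_dvd _).1 h1)
          (abs_lt.2 ⟨by lia, by lia⟩)
        lia
      have h2 := geom_sum_mul ((z : ℂ) ^ (l - k)) m
      rw [← zpow_natCast ((z : ℂ) ^ (l - k)), zpow_comm, zpow_natCast, hz.pow_eq_one, one_zpow,
        sub_self] at h2
      exact (mul_eq_zero.1 h2).resolve_right (sub_ne_zero.2 h1)
  have hj : ∀ j : ℕ, (((z : ℂ) ^ (-k)) ^ j) • (gauge A (z ^ j) * X * gauge A (z ^ j)⁻¹) =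
      ∑ l ∈ Finset.Icc (-d : ℤ) d, ((z : ℂ) ^ (l - k)) ^ j • G.F (f l) := by
    intro j
    rw [hX, map_sum, Finset.mul_sum, Finset.sum_mul, Finset.smul_sum]
    refine Finset.sum_congr rfl fun l _ => ?_
    rw [G.gauge_conj_F _ (hf l), smul_smul, Circle.coe_pow, ← zpow_natCast (z : ℂ) j, zpow_comm,
      zpow_natCast, ← mul_pow, ← zpow_add₀ hz0, neg_add_eq_sub]
  have havg : (m : ℂ) • G.F (f k) = ∑ j ∈ Finset.range m,
      (((z : ℂ) ^ (-k)) ^ j) • (gauge A (z ^ j) * X * gauge A (z ^ j)⁻¹) := by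
    simp only [hj]
    rw [Finset.sum_comm]
    simp only [← Finset.sum_smul]
    rw [Finset.sum_congr rfl fun l hl => by rw [hsum l hl]]
    simp only [ite_smul, zero_smul]
    rw [Finset.sum_ite_eq', if_pos hk]
  have hm0 : (0 : ℝ) < m := by positivity
  refine le_of_mul_le_mul_left ?_ hm0
  calc (m : ℝ) * ‖G.F (f k)‖ = ‖(m : ℂ) • G.F (f k)‖ := by rw [norm_smul, Complex.norm_natCast]
    _ ≤ ∑ j ∈ Finset.range m, ‖X‖ := by
        rw [havg]
        refine (norm_sum_le _ _).trans (Finset.sum_le_sum fun j _ => ?_)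
        rw [norm_smul, norm_pow, norm_zpow, Circle.norm_coe, one_zpow, one_pow, one_mul]
        calc _ ≤ 1 * ‖X‖ * 1 := (norm_mul_le _ _).trans <| by
              gcongr
              · refine (norm_mul_le _ _).trans ?_
                gcongr
                exact norm_gauge_le _
              · exact norm_gauge_le _
          _ = ‖X‖ := by ring
    _ = m * ‖X‖ := by simp

theorem norm_le_mul_norm_F_of_mem_polys {x : D} (hx : x ∈ G.polys N d) :
    ‖x‖ ≤ (2 * d + 1) * ‖G.F x‖ := by
  obtain ⟨f, hf, rfl⟩ := G.exists_homogeneous_decomposition hx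
  calc _ ≤ ∑ k ∈ Finset.Icc (-d : ℤ) d, ‖G.F (∑ l ∈ Finset.Icc (-d : ℤ) d, f l)‖ :=
        (norm_sum_le _ _).trans (Finset.sum_le_sum fun k hk =>
          (G.norm_le_norm_F_of_mem_homogPolys (hf k)).trans (G.norm_F_homogeneous_le hf hk))
    _ = _ := by
        rw [Finset.sum_const, Int.card_Icc, nsmul_eq_mul]
        congr 1
        have : ((d : ℤ) + 1 - -d).toNat = 2 * d + 1 := by lia
        rw [this]
        push_cast
        ring

/-- The constant `2d + 1` is linear in the degree, and the degree doubles with each squaring. -/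
theorem norm_le_norm_F_of_mem_polys {x : D} (hx : x ∈ G.polys N d) : ‖x‖ ≤ ‖G.F x‖ := by
  have key : ‖star x * x‖ ≤ ‖G.F (star x * x)‖ := by
    refine norm_le_norm_map_of_growth G.F
      (fun k => {z | z ∈ G.polys N (2 ^ k * (2 * d)) ∧ IsSelfAdjoint z})
      (fun k z hz => ⟨?_, by rw [isSelfAdjoint_iff, star_mul, hz.2.star_eq]⟩)
      -- Since `x⋆ x` has degree at most `2 d`, its `2 ^ k`-th power has constant `2 (2 ^ k * 2 d) +
      -- 1 ≤ (4 d + 1) 2 ^ k`.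
      (fun _ z hz => hz.2) (4 * d + 1) (fun k z hz => ?_)
      ⟨?_, IsSelfAdjoint.star_mul_self x⟩
    · have := G.mul_mem_polys hz.1 hz.1
      rwa [← mul_assoc, ← pow_succ'] at this
    · refine (G.norm_le_mul_norm_F_of_mem_polys hz.1).trans ?_
      gcongr
      push_cast
      nlinarith [one_le_pow₀ (n := k) (one_le_two (α := ℝ))]
    · simpa using G.mul_mem_polys (G.star_mem_polys hx) hx
  rw [map_mul, map_star, CStarRing.norm_star_mul_self, CStarRing.norm_star_mul_self] at key
  by_contra! hlt
  nlinarith [norm_nonneg (G.F x)]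

/-- The polynomials in the generators. -/
def polyAlgebra : NonUnitalStarSubalgebra ℂ D where
  carrier := {x | ∃ N d, x ∈ G.polys N d}
  zero_mem' := ⟨0, 0, Submodule.zero_mem _⟩
  add_mem' := by
    rintro x y ⟨N, d, hx⟩ ⟨M, e, hy⟩
    exact ⟨max N M, max d e, Submodule.add_mem _
      (G.polys_mono (le_max_left _ _) (le_max_left _ _) hx)
      (G.polys_mono (le_max_right _ _) (le_max_right _ _) hy)⟩
  mul_mem' := by
    rintro x y ⟨N, d, hx⟩ ⟨M, e, hy⟩
    exact ⟨max N M, 2 * max d e, G.mul_mem_polys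
      (G.polys_mono (le_max_left _ _) (le_max_left _ _) hx)
      (G.polys_mono (le_max_right _ _) (le_max_right _ _) hy)⟩
  smul_mem' := by
    rintro c x ⟨N, d, hx⟩
    exact ⟨N, d, Submodule.smul_mem _ c hx⟩
  star_mem' := by
    rintro x ⟨N, d, hx⟩
    exact ⟨N, d, G.star_mem_polys hx⟩

theorem mul_star_mem_polyAlgebra {N p q : ℕ} {u v : D} (hu : u ∈ G.words N p)
    (hv : v ∈ G.words N q) : u * star v ∈ G.polyAlgebra :=
  ⟨N, max p q, Submodule.subset_span
    ⟨p, le_max_left _ _, q, le_max_right _ _, u, hu, v, hv, rfl⟩⟩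

/-- Without a unit in `A` the generators need not have the form `u v⋆`, but `π(a)` and `S_i(a)` are
limits of `π(a e) π(e)⋆` and `S_i(a e) π(e)⋆`. -/
theorem mem_closure_polyAlgebra (x : D) : x ∈ closure (G.polyAlgebra : Set D) := by
  obtain ⟨l, hl, -, -, -, h, -⟩ := exists_approximateUnit A
  have hle : (NonUnitalStarAlgebra.adjoin ℂ
      (Set.range G.π ∪ ⋃ i, Set.range (G.S i))).topologicalClosure ≤
        G.polyAlgebra.topologicalClosure := by
    refine NonUnitalStarSubalgebra.topologicalClosure_minimal _
      (NonUnitalStarAlgebra.adjoin_le ?_) G.polyAlgebra.isClosed_topologicalClosure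
    rintro _ (⟨a, rfl⟩ | hx)
    · refine mem_closure_of_tendsto (((G.continuous_π).tendsto a).comp (h a))
        (.of_forall fun e => ?_)
      rw [Function.comp_apply, map_mul, map_star]
      exact G.mul_star_mem_polyAlgebra (N := 0) (p := 0) (q := 0) ⟨_, rfl⟩ ⟨_, rfl⟩
    · obtain ⟨i, a, rfl⟩ := Set.mem_iUnion.1 hx
      refine mem_closure_of_tendsto (((G.continuous_S i).tendsto a).comp (h a))
        (.of_forall fun e => ?_)
      rw [Function.comp_apply, ← G.S_mul_π, ← G.S_mul_π, map_star]
      exact G.mul_star_mem_polyAlgebra (N := i + 1) (p := 1) (q := 0)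
        ⟨i, i.lt_succ_self, a, _, ⟨_, rfl⟩, rfl⟩ ⟨_, rfl⟩
  rw [G.dense] at hle
  exact hle NonUnitalStarAlgebra.mem_top

/-- The Toeplitz algebra acts faithfully on the Fock space. -/
theorem norm_F (x : D) : ‖G.F x‖ = ‖x‖ := by
  refine le_antisymm (G.norm_F_le x) ?_
  have hc : Continuous G.F := AddMonoidHomClass.continuous_of_bound G.F 1 fun a => by
    rw [one_mul]
    exact G.norm_F_le a
  have hs : IsClosed {x | ‖x‖ ≤ ‖G.F x‖} := isClosed_le continuous_norm hc.norm
  refine hs.closure_subset_iff.2 ?_ (G.mem_closure_polyAlgebra x)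
  rintro y ⟨N, d, hy⟩
  exact G.norm_le_norm_F_of_mem_polys hy

theorem injective_F : Function.Injective G.F := by
  refine (injective_iff_map_eq_zero G.F).2 fun x hx => ?_
  rw [← norm_eq_zero, ← G.norm_F, hx, norm_zero]

end Polynomials

end FockCover

/-! ### Closed ideals that meet `A` trivially -/

section Ideals

variable {A : Type u} [NonUnitalCStarAlgebra A] {D : Type w} [NonUnitalCStarAlgebra D]

/-- Cut-offs of a positive element by functional calculus. -/
theorem exists_cutoff (b : A) {s : ℝ} (hs : 0 < s) (hb : s < ‖star b * b‖) :
    ∃ x y : A, x ≠ 0 ∧ x * (star b * b) * y = x ∧ ‖y‖ ≤ 1 / s := by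
  let _ := CStarAlgebra.spectralOrder A
  have _ := CStarAlgebra.spectralOrderedRing A
  set a := star b * b with ha
  have ha0 : 0 ≤ a := star_mul_self_nonneg b
  have hsa : IsSelfAdjoint a := IsSelfAdjoint.star_mul_self b
  have hσ : ∀ t ∈ quasispectrum ℝ a, 0 ≤ t := quasispectrum_nonneg_of_nonneg a ha0
  -- The function `g` is `1 / t` for `t ≥ s`, where `f` is supported, and is continued linearly to
  -- `g 0 = 0` so that the non-unital calculus applies; hence `f · t · g = f` and `|g| ≤ 1 / s`.
  -- Since `f + m` is the identity, `f(a) = 0` would give `‖a‖ = ‖m(a)‖ ≤ s`.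
  let f : ℝ → ℝ := fun t => max (t - s) 0
  let g : ℝ → ℝ := fun t => t / max t s ^ 2
  let m : ℝ → ℝ := fun t => min t s
  have hmax : ∀ t : ℝ, 0 < max t s := fun t => lt_max_of_lt_right hs
  have hf : Continuous f := by fun_prop
  have hm : Continuous m := by fun_prop
  have hg : Continuous g := continuous_id.div (by fun_prop) fun t => (pow_pos (hmax t) 2).ne'
  have hf0 : f 0 = 0 := by simp [f, hs.le]
  have hm0 : m 0 = 0 := by simp [m, hs.le]
  have hg0 : g 0 = 0 := by simp [g]
  have hid : cfcₙ (fun t : ℝ => t) a = a := cfcₙ_id' ℝ a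
  refine ⟨cfcₙ f a, cfcₙ g a, fun h => ?_, ?_, norm_cfcₙ_le fun t ht => ?_⟩
  · have h1 : cfcₙ (fun t => f t + m t) a = cfcₙ f a + cfcₙ m a :=
      cfcₙ_add f m a hf.continuousOn hf0 hm.continuousOn hm0
    have h2 : (fun t => f t + m t) = fun t => t := funext fun t => by
      simp only [f, m]
      rcases le_total t s with h | h
      · rw [max_eq_right (by linarith), min_eq_left h, zero_add]
      · rw [max_eq_left (by linarith), min_eq_right h, sub_add_cancel]
    rw [h2, hid, h, zero_add] at h1
    have h3 : ‖cfcₙ m a‖ ≤ s := norm_cfcₙ_le fun t ht => by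
      rw [Real.norm_of_nonneg (le_min (hσ t ht) hs.le)]
      exact min_le_right _ _
    rw [← h1] at h3
    linarith
  · have h1 : cfcₙ (fun t => f t * t) a = cfcₙ f a * a := by
      rw [cfcₙ_mul f (fun t => t) a hf.continuousOn hf0 continuousOn_id rfl, hid]
    rw [← h1, ← cfcₙ_mul (fun t => f t * t) g a (hf.mul continuous_id).continuousOn (by simp)
      hg.continuousOn hg0]
    congr 1
    funext t
    simp only [f, g]
    rcases le_total t s with h | h
    · rw [max_eq_right (by linarith), zero_mul, zero_mul]
    · have : t ≠ 0 := (hs.trans_le h).ne'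
      rw [max_eq_left h]
      field_simp
  · have h0 := hσ t ht
    rw [Real.norm_of_nonneg (by positivity), div_le_div_iff₀ (pow_pos (hmax t) 2) hs, one_mul, sq]
    exact mul_le_mul (le_max_left _ _) (le_max_right _ _) hs.le (hmax t).le

/-- An injective homomorphism to the quotient by a closed ideal is isometric. -/
theorem norm_le_norm_sub_of_mem (π : A →⋆ₙₐ[ℂ] D) (J : TwoSidedIdeal D)
    (hJ : IsClosed (J : Set D)) (h0 : ∀ a, π a ∈ J → a = 0) (b : A) {j : D} (hj : j ∈ J) :
    ‖b‖ ≤ ‖π b - j‖ := by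
  have key : ∀ j ∈ J, ‖star b * b‖ ≤ ‖π (star b * b) - j‖ := by
    intro j hj
    by_contra! hlt
    obtain ⟨r, hr, hr'⟩ := exists_between hlt
    obtain ⟨s, hs, hs'⟩ := exists_between hr'
    have hr0 : 0 < r := (norm_nonneg _).trans_lt hr
    have hs0 : 0 < s := hr0.trans hs
    obtain ⟨x, y, hx, hxy, hy⟩ := exists_cutoff b hs0 hs'
    refine hx (h0 x ?_)
    change π x ∈ (J : Set D)
    rw [hJ.mem_iff_infDist_zero ⟨0, J.zero_mem⟩]
    by_contra hne
    have hpos : 0 < Metric.infDist (π x) J := lt_of_le_of_ne Metric.infDist_nonneg (Ne.symm hne)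
    -- Modulo `J`, `π x = π x · π(b⋆ b) · π y` is equal to `(π x - i)(π(b⋆ b) - j) π y`. With `‖π x
    -- - i‖ < (s / r) dist(π x, J)`, middle factor of norm less than `r` and `‖y‖ ≤ 1 / s`, this
    -- product has norm less than `dist(π x, J)`, which is absurd.
    have h1 : Metric.infDist (π x) J < s / r * Metric.infDist (π x) J :=
      lt_mul_of_one_lt_left hpos ((one_lt_div hr0).2 hs)
    obtain ⟨i, hi, h2⟩ := (Metric.infDist_lt_iff ⟨0, J.zero_mem⟩).1 h1
    rw [dist_eq_norm] at h2
    have hmem : π x - (π x - i) * (π (star b * b) - j) * π y ∈ J := by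
      have : π x - (π x - i) * (π (star b * b) - j) * π y =
          i * (π (star b * b) - j) * π y + π x * j * π y := by
        have e : π x * π (star b * b) * π y = π x := by rw [← map_mul, ← map_mul, hxy]
        calc _ = π x * π (star b * b) * π y - (π x - i) * (π (star b * b) - j) * π y := by rw [e]
          _ = _ := by noncomm_ring
      rw [this]
      exact J.add_mem (J.mul_mem_right _ _ (J.mul_mem_right _ _ hi))
        (J.mul_mem_right _ _ (J.mul_mem_left _ _ hj))
    have h3 := Metric.infDist_le_dist_of_mem (x := π x) (s := (J : Set D)) hmem
    rw [dist_eq_norm, sub_sub_cancel] at h3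
    have h4 : ‖(π x - i) * (π (star b * b) - j) * π y‖ ≤ ‖π x - i‖ * r * (1 / s) := by
      refine (norm_mul_le _ _).trans ?_
      gcongr
      · exact (norm_mul_le _ _).trans (by gcongr)
      · exact (NonUnitalStarAlgHom.norm_apply_le π y).trans hy
    have h5 : ‖π x - i‖ * r * (1 / s) < s / r * Metric.infDist (π x) J * r * (1 / s) := by
      gcongr
    have h6 : s / r * Metric.infDist (π x) J * r * (1 / s) = Metric.infDist (π x) J := by
      field_simp
    linarith
  -- The general case uses the element `π(b)⋆ j` of `J`: `‖b‖ ^ 2 ≤ ‖π(b)⋆ (π b - j)‖ ≤ ‖b‖ ‖π b -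
  -- j‖`.
  have h1 := key _ (J.mul_mem_left (star (π b)) j hj)
  rw [map_mul, map_star, ← mul_sub, CStarRing.norm_star_mul_self] at h1
  have h2 : ‖star (π b) * (π b - j)‖ ≤ ‖b‖ * ‖π b - j‖ := (norm_mul_le _ _).trans <| by
    rw [norm_star]
    gcongr
    exact NonUnitalStarAlgHom.norm_apply_le π b
  by_contra! hlt
  nlinarith [norm_nonneg (π b - j)]

end Ideals

/-! ### Non-degenerate endomorphisms -/

section Nondegenerate

variable {A : Type u} [NonUnitalCStarAlgebra A]

theorem IsNondegenerate.eq_zero {f : A →⋆ₙₐ[ℂ] A} (hf : IsNondegenerate f) (L : A →L[ℂ] A)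
    (h : ∀ a b, L (f a * b) = 0) (c : A) : L c = 0 := by
  have : L = 0 := ContinuousLinearMap.ext_on hf (by rintro _ ⟨a, b, rfl⟩; exact h a b)
  rw [this]
  rfl

theorem isNondegenerate_id : IsNondegenerate (NonUnitalStarAlgHom.id ℂ A) := by
  obtain ⟨l, hl, -, h, -⟩ := exists_approximateUnit A
  intro a
  exact mem_closure_of_tendsto (h a) (.of_forall fun e => Submodule.subset_span ⟨a, e, rfl⟩)

/-- From `f(g(a) b') b = f(g(a)) (f(b') b)` and the density of the span of the `g(a) b'`, the closed
span for `f ∘ g` contains every `f(d) b`. -/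
theorem IsNondegenerate.comp {f g : A →⋆ₙₐ[ℂ] A} (hf : IsNondegenerate f)
    (hg : IsNondegenerate g) : IsNondegenerate (f.comp g) := by
  let M : Submodule ℂ A :=
    (Submodule.span ℂ {x : A | ∃ a b : A, x = f.comp g a * b}).topologicalClosure
  have hfc : Continuous f := AddMonoidHomClass.continuous_of_bound f 1 fun a => by
    rw [one_mul]
    exact norm_map_le f a
  have h1 : ∀ d b, f d * b ∈ M := by
    intro d b
    have hcl : IsClosed {d | f d * b ∈ (M : Set A)} :=
      (Submodule.isClosed_topologicalClosure _).preimage (hfc.mul_const b)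
    refine hcl.closure_subset_iff.2 ?_ (hg d)
    intro x hx
    change f x * b ∈ M
    induction hx using Submodule.span_induction with
    | zero => rw [map_zero, zero_mul]; exact M.zero_mem
    | add x y _ _ h1 h2 => rw [map_add, add_mul]; exact M.add_mem h1 h2
    | smul c x _ h => rw [map_smul, smul_mul_assoc]; exact M.smul_mem c h
    | mem x hx =>
      obtain ⟨a, b', rfl⟩ := hx
      refine Submodule.le_topologicalClosure _ (Submodule.subset_span ⟨a, f b' * b, ?_⟩)
      rw [map_mul, mul_assoc]
      rfl
  have h2 : Submodule.span ℂ {x : A | ∃ a b : A, x = f a * b} ≤ M :=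
    Submodule.span_le.2 (by rintro _ ⟨a, b, rfl⟩; exact h1 a b)
  intro x
  exact (closure_minimal h2 (Submodule.isClosed_topologicalClosure _)) (hf x)

theorem isNondegenerate_wordEnd {ρ : ℕ → A →⋆ₙₐ[ℂ] A} (h : ∀ n, IsNondegenerate (ρ n))
    (w : List ℕ) : IsNondegenerate (wordEnd ρ w) := by
  induction w with
  | nil => exact isNondegenerate_id
  | cons i w ih => exact ih.comp (h i)

end Nondegenerate

/-! ### Vacuum components and compression by generators of large index -/

namespace FockCover

variable {A : Type u} [NonUnitalCStarAlgebra A] {ρ : ℕ → A →⋆ₙₐ[ℂ] A} {D : Type w}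
  [NonUnitalCStarAlgebra D] (G : FockCover ρ D)

/-- Up to an approximate unit, `ρ_k` is compression by `S_k`. This brings the endomorphisms into
contact with ideals of `D`. -/
theorem S_compress_π (k : ℕ) (a b c : A) :
    star (G.S k b) * G.π a * G.S k c = G.π (star b * ρ k a * c) := by
  rw [mul_assoc, G.π_mul_S, G.star_S_mul_S, if_pos rfl, mul_assoc]

/-- A polynomial `x` has a component `a` in `A`, which describes the compressions of `x` by
generators with a large index and by the vacuum. -/
theorem exists_vacuum_component {N d : ℕ} {x : D} (hx : x ∈ G.polys N d) :
    ∃ a, (∀ k ≥ N, ∀ e, star (G.S k e) * x * G.S k e = G.π (star e * ρ k a * e)) ∧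
      ∀ c, (G.F x).1 (L2.single [] c) [] = a * c := by
  induction hx using Submodule.span_induction with
  | zero => exact ⟨0, by simp, fun c => by rw [map_zero, zero_mul]; rfl⟩
  | add x y _ _ h1 h2 =>
    obtain ⟨a, ha, ha'⟩ := h1
    obtain ⟨b, hb, hb'⟩ := h2
    refine ⟨a + b, fun k hk e => ?_, fun c => ?_⟩
    · rw [mul_add, add_mul, ha k hk, hb k hk, map_add, mul_add, add_mul, map_add]
    · rw [map_add, Adj.add_apply, L2.add_apply, ha', hb', add_mul]
  | smul c x _ h =>
    obtain ⟨a, ha, ha'⟩ := h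
    refine ⟨c • a, fun k hk e => ?_, fun c => ?_⟩
    · rw [mul_smul_comm, smul_mul_assoc, ha k hk, map_smul, mul_smul_comm, smul_mul_assoc,
        map_smul]
    · rw [map_smul, Adj.smul_apply, L2.smul_apply, ha', smul_mul_assoc]
  | mem x hx =>
    obtain ⟨p, -, q, -, u, hu, v, hv, rfl⟩ := hx
    have h0 : ∀ {i k : ℕ} (a b : A), i < N → N ≤ k → star (G.S k a) * G.S i b = 0 := by
      intro i k a b hi hk
      rw [G.star_S_mul_S, if_neg (by lia), map_zero]
    -- A letter `k ≥ N` is orthogonal to every letter of `u` and `v`, and the vacuum corner ignores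
    -- terms with letters as well. So `u v⋆` contributes only when both words are empty.
    cases p with
    | succ p =>
      obtain ⟨i, hi, a, y, -, rfl⟩ := hu
      refine ⟨0, fun k hk e => ?_, fun c => ?_⟩
      · rw [← mul_assoc, ← mul_assoc, h0 _ _ hi hk]
        simp
      · rw [mul_assoc, G.F_S_mul_apply_nil, zero_mul]
    | zero =>
      cases q with
      | succ q =>
        obtain ⟨i, hi, a, y, -, rfl⟩ := hv
        refine ⟨0, fun k hk e => ?_, fun c => ?_⟩
        · have h1 : star (G.S i a) * G.S k e = 0 := by
            rw [← star_star (G.S k e), ← star_mul, h0 _ _ hi hk, star_zero]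
          rw [star_mul, mul_assoc, mul_assoc, mul_assoc, h1]
          simp
        · rw [star_mul, ← mul_assoc, map_mul, Adj.mul_apply, G.F_star_S_apply_single_nil, map_zero,
            zero_mul]
          rfl
      | zero =>
        obtain ⟨a, rfl⟩ := hu
        obtain ⟨b, rfl⟩ := hv
        refine ⟨a * star b, fun k _ e => ?_, fun c => ?_⟩
        · rw [← map_star G.π, ← map_mul G.π, G.S_compress_π]
        · rw [← map_star, ← map_mul, G.F_π_apply_nil, L2.single_apply_same]

/-- If the compressions of `x` by the generators are far from `A`, then the vacuum component of
`x` vanishes. -/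
theorem vacuum_eq_zero (hnorm : ∀ a : A, limsup (fun n => ‖ρ n a‖) atTop = ‖a‖) {x : D}
    (h : ∀ k e b, ‖b‖ ≤ ‖G.π b - star (G.S k e) * x * G.S k e‖) (c : A) :
    (G.F x).1 (L2.single [] c) [] = 0 := by
  rw [← norm_le_zero_iff]
  refine le_of_forall_pos_le_add fun ε hε => ?_
  set δ := ε / (3 * (‖c‖ + 1)) with hδ
  have hδ0 : 0 < δ := by positivity
  obtain ⟨y, ⟨N, d, hy⟩, hxy⟩ := Metric.mem_closure_iff.1 (G.mem_closure_polyAlgebra x) δ hδ0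
  rw [dist_eq_norm] at hxy
  obtain ⟨a, ha, ha'⟩ := G.exists_vacuum_component hy
  -- The limsup condition gives such indices beyond `N`, as the compression formula for `y`
  -- requires.
  have hfreq : ∃ᶠ n in atTop, ‖a‖ - δ < ‖ρ n a‖ := by
    refine frequently_lt_of_lt_limsup ?_ ?_
    · exact (isBoundedUnder_of ⟨0, fun n => norm_nonneg _⟩ :
        IsBoundedUnder (· ≥ ·) atTop fun n => ‖ρ n a‖).isCoboundedUnder_flip
    · rw [hnorm]
      linarith
  obtain ⟨k, hk, hka⟩ := (hfreq.and_eventually (eventually_ge_atTop N)).exists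
  obtain ⟨l, hl, h1, -, -, -, h2⟩ := exists_approximateUnit A
  -- The compressions of `x` and `y` differ by at most `δ`, and the hypothesis on `x` bounds `e⋆
  -- ρ_k(a) e` by that difference. Together with the choice of `k` this gives `‖a‖ < 2 δ`.
  have hρ : ‖ρ k a‖ ≤ δ := by
    refine le_of_tendsto (h2 (ρ k a)).norm (h1.mono fun e he => ?_)
    have hS : ‖G.S k e‖ ≤ 1 := (G.norm_S_le k e).trans he
    refine (h k e _).trans ?_
    rw [← ha k hka, ← sub_mul, ← mul_sub]
    calc _ ≤ ‖star (G.S k e)‖ * ‖y - x‖ * ‖G.S k e‖ :=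
          (norm_mul_le _ _).trans (by gcongr; exact norm_mul_le _ _)
      _ ≤ 1 * δ * 1 := by
          rw [norm_star, norm_sub_rev]
          gcongr
      _ = δ := by ring
  have hF : ‖(G.F (x - y)).1 (L2.single [] c) []‖ ≤ δ * ‖c‖ := by
    refine (L2.norm_apply_le _ _).trans ((ContinuousLinearMap.le_opNorm _ _).trans ?_)
    gcongr
    · exact (G.norm_F_le _).trans hxy.le
    · exact L2.norm_single_le [] c
  have hsplit : (G.F x).1 (L2.single [] c) [] = (G.F (x - y)).1 (L2.single [] c) [] + a * c := by
    rw [← ha', ← L2.add_apply, ← Adj.add_apply, ← map_add, sub_add_cancel]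
  rw [hsplit, zero_add]
  calc _ ≤ δ * ‖c‖ + ‖a‖ * ‖c‖ := (norm_add_le _ _).trans (add_le_add hF (norm_mul_le _ _))
    _ ≤ δ * ‖c‖ + (2 * δ) * ‖c‖ := by
        gcongr
        linarith
    _ ≤ (3 * (‖c‖ + 1)) * δ := by nlinarith [norm_nonneg c]
    _ = ε := by rw [hδ]; field_simp

/-- The coefficient `ρ_w(a) b` that appears here is why non-degeneracy is needed for the
endomorphisms of all words: such coefficients must span a dense subspace of `A`. -/
theorem F_S_apply_single (i : ℕ) (a : A) (w : List ℕ) (b : A) :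
    (G.F (G.S i a)).1 (L2.single w b) = L2.single (i :: w) (wordEnd ρ w a * b) := by
  rw [G.F_S, Adj.mul_apply]
  have h1 : (fockLeft ρ a).1 (L2.single w b) = L2.single w (wordEnd ρ w a * b) :=
    L2.ext fun v => by
      change wordEnd ρ v a * (L2.single w b : L2 (List ℕ) A) v = _
      by_cases h : v = w
      · subst h
        rw [L2.single_apply_same, L2.single_apply_same]
      · rw [L2.single_apply_of_ne h, L2.single_apply_of_ne h, mul_zero]
  rw [h1]
  refine L2.ext fun v => ?_
  by_cases h : ∃ v', i :: v' = v
  · obtain ⟨v', rfl⟩ := h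
    rw [fockShift, shift_apply (List.cons i) List.cons_injective]
    by_cases h : v' = w
    · subst h
      rw [L2.single_apply_same, L2.single_apply_same]
    · rw [L2.single_apply_of_ne h, L2.single_apply_of_ne (by simpa using h)]
  · rw [fockShift, shift_apply' _ _ _ _ h, L2.single_apply_of_ne]
    rintro rfl
    exact h ⟨w, rfl⟩

/-! ### The dichotomy for closed ideals -/

section Ideal

variable {J : TwoSidedIdeal D}

/-- An ideal on which the vacuum expectation vanishes acts trivially on the Fock space. -/
theorem F_eq_zero_of_vacuum (hnd : ∀ n, IsNondegenerate (ρ n))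
    (h : ∀ x ∈ J, ∀ c, (G.F x).1 (L2.single [] c) [] = 0) {x : D} (hx : x ∈ J) : G.F x = 0 := by
  -- First the vacuum row: column `i :: w` of `x` on `ρ_w(a) b` is column `w` of `x S_i(a)`, which
  -- is again in `J`.
  have h1 : ∀ w : List ℕ, ∀ x ∈ J, ∀ c, (G.F x).1 (L2.single w c) [] = 0 := by
    intro w
    induction w with
    | nil => exact h
    | cons i w ih =>
      intro x hx c
      let L : A →L[ℂ] A := (coordCLM []).comp ((G.F x).1.comp (singleCLM (i :: w)))
      change L c = 0
      refine (isNondegenerate_wordEnd hnd w).eq_zero L (fun a b => ?_) c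
      change (G.F x).1 (L2.single (i :: w) (wordEnd ρ w a * b)) [] = 0
      rw [← G.F_S_apply_single, ← Adj.mul_apply, ← map_mul]
      exact ih _ (J.mul_mem_right _ _ hx) b
  -- The other rows are reduced in the same way by left multiplication with `S_i(a)⋆`.
  have h2 : ∀ w : List ℕ, ∀ x ∈ J, ∀ ξ, (G.F x).1 ξ w = 0 := by
    intro w
    induction w with
    | nil => exact fun x hx => Adj.apply_eq_zero fun w c => h1 w x hx c
    | cons i w ih =>
      intro x hx ξ
      have h3 : ∀ c, star ((G.F x).1 ξ (i :: w)) * c = 0 := by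
        refine (isNondegenerate_wordEnd hnd w).eq_zero
          (ContinuousLinearMap.mul ℂ A (star ((G.F x).1 ξ (i :: w)))) fun a b => ?_
        rw [ContinuousLinearMap.mul_apply', ← star_star (wordEnd ρ w a * b), ← star_mul,
          ← L2.inner_single, ← G.F_S_apply_single, Adj.inner_apply_left, ← map_star,
          ← Adj.mul_apply, ← map_mul, L2.inner_single, ih _ (J.mul_mem_left _ _ hx), mul_zero,
          star_zero]
      exact eq_zero_of_forall_star_mul fun b => by
        rw [← star_star ((G.F x).1 ξ (i :: w)), ← star_mul, h3, star_zero]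
  exact Adj.ext fun ξ => L2.ext fun w => h2 w x hx ξ

/-- Compressions of elements of `J` stay in `J`, and `A` is isometric modulo `J`, so every vacuum
corner vanishes on `J`. Hence `F` vanishes on `J`, and `F` is injective. -/
theorem eq_bot_of_forall_π_mem (hnd : ∀ n, IsNondegenerate (ρ n))
    (hnorm : ∀ a : A, limsup (fun n => ‖ρ n a‖) atTop = ‖a‖) (hJ : IsClosed (J : Set D))
    (h0 : ∀ a, G.π a ∈ J → a = 0) : J = ⊥ := by
  refine le_bot_iff.1 fun x hx => ?_
  change x ∈ (⊥ : TwoSidedIdeal D)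
  rw [TwoSidedIdeal.mem_bot]
  refine G.injective_F ?_
  rw [map_zero]
  refine G.F_eq_zero_of_vacuum hnd (fun y hy c => G.vacuum_eq_zero hnorm (fun k e b => ?_) c) hx
  exact norm_le_norm_sub_of_mem G.π J hJ h0 b (J.mul_mem_right _ _ (J.mul_mem_left _ _ hy))

theorem eq_top_of_forall_π_mem (hJ : IsClosed (J : Set D)) (h : ∀ a, G.π a ∈ J) : J = ⊤ := by
  obtain ⟨l, hl, -, -, -, hl', -⟩ := exists_approximateUnit A
  have hS : ∀ i a, G.S i a ∈ J := fun i a => by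
    refine hJ.mem_of_tendsto (((G.continuous_S i).tendsto a).comp (hl' a)) (.of_forall fun e => ?_)
    rw [Function.comp_apply, ← G.S_mul_π]
    exact J.mul_mem_left _ _ (h _)
  have hw : ∀ N p, ∀ x ∈ G.words N p, x ∈ J := by
    intro N p x hx
    cases p with
    | zero =>
      obtain ⟨a, rfl⟩ := hx
      exact h a
    | succ p =>
      obtain ⟨i, -, a, y, -, rfl⟩ := hx
      exact J.mul_mem_right _ _ (hS i a)
  -- A two-sided ring ideal is not assumed stable under scalars; on products `u v⋆` the scalar is
  -- absorbed by `v⋆`.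
  have hp : ∀ N d, ∀ x ∈ G.polys N d, ∀ c : ℂ, c • x ∈ J := by
    intro N d x hx
    induction hx using Submodule.span_induction with
    | zero => intro c; rw [smul_zero]; exact J.zero_mem
    | add x y _ _ h1 h2 => intro c; rw [smul_add]; exact J.add_mem (h1 c) (h2 c)
    | smul c x _ h => intro c'; rw [smul_smul]; exact h _
    | mem x hx =>
      obtain ⟨p, -, q, -, u, hu, v, hv, rfl⟩ := hx
      intro c
      rw [← mul_smul_comm]
      exact J.mul_mem_right _ _ (hw _ _ u hu)
  refine top_le_iff.1 fun x _ => ?_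
  refine hJ.closure_subset_iff.2 ?_ (G.mem_closure_polyAlgebra x)
  rintro y ⟨N, d, hy⟩
  simpa using hp N d y hy 1

theorem eq_bot_or_eq_top (G : FockCover ρ D) (hnd : ∀ n, IsNondegenerate (ρ n))
    (hnorm : ∀ a : A, limsup (fun n => ‖ρ n a‖) atTop = ‖a‖)
    (hideal : ∀ I : TwoSidedIdeal A, IsClosed (I : Set A) →
      (∀ n, ∀ a ∈ I, ρ n a ∈ I) → I = ⊥ ∨ I = ⊤) (hJ : IsClosed (J : Set D)) :
    J = ⊥ ∨ J = ⊤ := by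
  have hmem : ∀ a, a ∈ J.comap G.π ↔ G.π a ∈ J := fun a => TwoSidedIdeal.mem_comap G.π
  have hcl : IsClosed (J.comap G.π : Set A) := by
    have : (J.comap G.π : Set A) = G.π ⁻¹' J := Set.ext hmem
    rw [this]
    exact hJ.preimage G.continuous_π
  -- `ρ_n(a)` is the limit of `e⋆ ρ_n(a) e`, whose image under `π` is `S_n(e)⋆ π(a) S_n(e) ∈ J`.
  have hinv : ∀ n, ∀ a ∈ J.comap G.π, ρ n a ∈ J.comap G.π := by
    intro n a ha
    obtain ⟨l, hl, -, -, -, -, h⟩ := exists_approximateUnit A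
    refine hcl.mem_of_tendsto (h (ρ n a)) (.of_forall fun e => ?_)
    change _ ∈ J.comap G.π
    rw [hmem, ← G.S_compress_π]
    exact J.mul_mem_right _ _ (J.mul_mem_left _ _ ((hmem a).1 ha))
  rcases hideal _ hcl hinv with h | h
  · refine Or.inl (G.eq_bot_of_forall_π_mem hnd hnorm hJ fun a ha => ?_)
    rw [← hmem, h, TwoSidedIdeal.mem_bot] at ha
    exact ha
  · refine Or.inr (G.eq_top_of_forall_π_mem hJ fun a => ?_)
    rw [← hmem, h]
    trivial

end Ideal

/-! ### Elements acting as compact operators on the vacuum summand -/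

section Vacuum

/-- The only possible nonzero matrix entry is the one from the vacuum to itself; this holds for the
rank one generators and is a closed linear condition. -/
theorem vacuumCompacts_apply {T : Adj (List ℕ) A} (hT : T ∈ vacuumCompacts A)
    (ξ : L2 (List ℕ) A) (w : List ℕ) (h : ξ [] = 0 ∨ w ≠ []) : T.1 ξ w = 0 := by
  let ev : Adj (List ℕ) A →ₗ[ℂ] A :=
    { toFun := fun S => S.1 ξ w
      map_add' := fun _ _ => rfl
      map_smul' := fun _ _ => rfl }
  have hev : Continuous ev := AddMonoidHomClass.continuous_of_bound ev ‖ξ‖ fun S => by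
    rw [mul_comm]
    exact (L2.norm_apply_le (S.1 ξ) w).trans (ContinuousLinearMap.le_opNorm S.1 ξ)
  have hle : Submodule.span ℂ {S : Adj (List ℕ) A | ∃ a b : A,
      S = Adj.rankOne (L2.single [] a) (L2.single [] b)} ≤ LinearMap.ker ev := by
    refine Submodule.span_le.2 ?_
    rintro _ ⟨a, b, rfl⟩
    change (L2.single [] a : L2 (List ℕ) A) w * L2.inner (L2.single [] b) ξ = 0
    rw [L2.inner_single]
    rcases h with h | h
    · rw [h, mul_zero, mul_zero]
    · have : (L2.single [] a : L2 (List ℕ) A) w = 0 := L2.single_apply_of_ne h _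
      rw [this, zero_mul]
  exact Submodule.topologicalClosure_minimal _ hle (isClosed_singleton.preimage hev) hT

theorem norm_π (a : A) : ‖G.π a‖ = ‖a‖ :=
  (G.norm_π_le a).antisymm <| (norm_le_of_vacuum fun c => by
    rw [G.F_π_apply_nil, L2.single_apply_same]).trans (G.norm_F_le _)

/-- The range of `F(S_k(e))` is orthogonal to the vacuum, so all compressions of `x` vanish. The
hypothesis of `vacuum_eq_zero` then reduces to `A` being isometrically embedded, and the one
remaining matrix entry of `F x` is zero. -/
theorem eq_zero_of_F_mem_vacuumCompacts
    (hnorm : ∀ a : A, limsup (fun n => ‖ρ n a‖) atTop = ‖a‖) {x : D}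
    (hx : G.F x ∈ vacuumCompacts A) : x = 0 := by
  refine G.injective_F ?_
  rw [map_zero]
  have hS : ∀ k e, star (G.S k e) * x * G.S k e = 0 := fun k e => by
    refine G.injective_F ?_
    rw [map_zero, map_mul, map_mul]
    refine Adj.ext fun ξ => ?_
    have h1 : (G.F x).1 ((G.F (G.S k e)).1 ξ) = 0 := L2.ext fun w => by
      refine vacuumCompacts_apply hx _ w (Or.inl ?_)
      rw [G.F_S]
      exact shift_apply' (List.cons k) List.cons_injective _ _ (by simp)
    rw [Adj.mul_apply, Adj.mul_apply, h1, map_zero]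
    rfl
  have h1 := G.vacuum_eq_zero hnorm (x := x) fun k e b => by rw [hS, sub_zero, G.norm_π]
  refine Adj.ext fun ξ => L2.ext fun w => Adj.apply_eq_zero (fun v c => ?_) ξ
  by_cases hw : w = []
  · subst hw
    by_cases hv : v = []
    · subst hv
      exact h1 c
    · exact vacuumCompacts_apply hx _ _ (Or.inl (L2.single_apply_of_ne (Ne.symm hv) c))
  · exact vacuumCompacts_apply hx _ _ (Or.inr hw)

end Vacuum

end FockCover

/-! ### The Toeplitz–Pimsner algebra as a `FockCover` -/

section Standard

variable {ι : Type v} {A : Type u} [NonUnitalCStarAlgebra A] [DecidableEq ι]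

/-- The squared norm of the error of a partial sum is the norm of the corresponding tail of `⟪x,
x⟫`. -/
theorem L2.hasSum_single_apply (x : L2 ι A) : HasSum (fun i => L2.single i (x i)) x := by
  have h : ∀ s : Finset ι, ‖∑ i ∈ s, L2.single i (x i) - x‖ =
      √‖∑ i ∈ s, star (x i) * x i - L2.inner x x‖ := by
    intro s
    have hs : ∀ j, (∑ i ∈ s, L2.single i (x i) : L2 ι A) j = if j ∈ s then x j else 0 := by
      intro j
      have : (∑ i ∈ s, L2.single i (x i) : L2 ι A) j =
          ∑ i ∈ s, (L2.single i (x i) : L2 ι A) j := map_sum (coordCLM j) _ _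
      rw [this]
      split_ifs with hj
      · rw [Finset.sum_eq_single j (fun i _ hi => L2.single_apply_of_ne (Ne.symm hi) _)
          (fun h => absurd hj h), L2.single_apply_same]
      · exact Finset.sum_eq_zero fun i hi =>
          L2.single_apply_of_ne (fun h => hj (by rw [h]; exact hi)) _
    have h1 : HasSum (fun i => if i ∈ s then star (x i) * x i else 0)
        (∑ i ∈ s, star (x i) * x i) := by
      have h0 : HasSum (fun i => if i ∈ s then star (x i) * x i else 0)
          (∑ i ∈ s, if i ∈ s then star (x i) * x i else 0) :=
        hasSum_sum_of_ne_finset_zero fun i hi => if_neg hi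
      rwa [Finset.sum_congr rfl fun i hi => if_pos hi] at h0
    have h2 : L2.inner (∑ i ∈ s, L2.single i (x i) - x) (∑ i ∈ s, L2.single i (x i) - x) =
        L2.inner x x - ∑ i ∈ s, star (x i) * x i := by
      refine (L2.hasSum_inner _ _).unique (((L2.hasSum_inner x x).sub h1).congr_fun fun i => ?_)
      rw [L2.sub_apply, hs]
      split_ifs <;> simp
    rw [L2.norm_def, h2, norm_sub_rev]
  refine tendsto_iff_norm_sub_tendsto_zero.2 ?_
  simp only [h]
  have h3 := (tendsto_iff_norm_sub_tendsto_zero.1 (L2.hasSum_inner x x))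
  simpa [Function.comp_def] using (Real.continuous_sqrt.tendsto _).comp h3

theorem diagRep_single (f : ι → A →⋆ₙₐ[ℂ] A) (a : A) (i : ι) (b : A) :
    (diagRep f a).1 (L2.single i b) = L2.single i (f i a * b) :=
  L2.ext fun j => by
    rw [diagRep_apply]
    by_cases h : j = i
    · subst h
      rw [L2.single_apply_same, L2.single_apply_same]
    · rw [L2.single_apply_of_ne h, L2.single_apply_of_ne h, mul_zero]

theorem rsmul_single (i : ι) (a b : A) : L2.rsmul (L2.single i a) b = L2.single i (a * b) :=
  L2.ext fun j => by
    rw [L2.rsmul_apply]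
    by_cases h : j = i
    · subst h
      rw [L2.single_apply_same, L2.single_apply_same]
    · rw [L2.single_apply_of_ne h, L2.single_apply_of_ne h, zero_mul]

theorem inner_single_single (i j : ι) (a b : A) :
    L2.inner (L2.single i a) (L2.single j b : L2 ι A) = if i = j then star a * b else 0 := by
  rw [L2.inner_single]
  split_ifs with h
  · subst h
    rw [L2.single_apply_same]
  · rw [L2.single_apply_of_ne h, mul_zero]

end Standard

namespace ToeplitzPimsner

variable {ι : Type v} {A : Type u} [NonUnitalCStarAlgebra A] (φ : A →⋆ₙₐ[ℂ] Adj ι A)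

variable {φ} in
theorem ext_rep {x y : ToeplitzPimsner φ} (h : ∀ r, x.1 r = y.1 r) : x = y :=
  Subtype.ext (lp.ext (funext h))

/-- The inclusion of `A` in `𝒯_E`. -/
def ofAHom : A →⋆ₙₐ[ℂ] ToeplitzPimsner φ where
  toFun := ofA φ
  map_smul' c a := ext_rep fun r => map_smul r.π c a
  map_zero' := ext_rep fun r => map_zero r.π
  map_add' a b := ext_rep fun r => map_add r.π a b
  map_mul' a b := ext_rep fun r => map_mul r.π a b
  map_star' a := ext_rep fun r => map_star r.π a

/-- The linear map `ξ ↦ T_ξ`. -/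
def TLin : L2 ι A →ₗ[ℂ] ToeplitzPimsner φ where
  toFun := T φ
  map_add' ξ η := ext_rep fun r => map_add r.t ξ η
  map_smul' c ξ := ext_rep fun r => map_smul r.t c ξ

theorem norm_TLin_le (ξ : L2 ι A) : ‖TLin φ ξ‖ ≤ ‖ξ‖ :=
  lp.norm_le_of_forall_le (norm_nonneg ξ) fun r => r.norm_t_le ξ

theorem continuous_TLin : Continuous (TLin φ) :=
  AddMonoidHomClass.continuous_of_bound (TLin φ) 1 fun ξ => by
    rw [one_mul]
    exact norm_TLin_le φ ξ

theorem ofAHom_mul_TLin (a : A) (ξ : L2 ι A) : ofAHom φ a * TLin φ ξ = TLin φ ((φ a).1 ξ) :=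
  ext_rep fun r => (r.t_left a ξ).symm

theorem TLin_mul_ofAHom (ξ : L2 ι A) (a : A) : TLin φ ξ * ofAHom φ a = TLin φ (L2.rsmul ξ a) :=
  ext_rep fun r => (r.t_right ξ a).symm

theorem star_TLin_mul_TLin (ξ η : L2 ι A) :
    star (TLin φ ξ) * TLin φ η = ofAHom φ (L2.inner ξ η) :=
  ext_rep fun r => r.t_inner ξ η

/-- Each `T_ξ` is the limit of finite sums of `T_{δ_i ⊗ ξ_i}`, so the elementary vectors suffice. -/
theorem topologicalClosure_adjoin_eq_top [DecidableEq ι] :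
    (NonUnitalStarAlgebra.adjoin ℂ (Set.range (ofAHom φ) ∪
      ⋃ i, Set.range ((TLin φ).comp (singleCLM (A := A) i).toLinearMap))).topologicalClosure =
        ⊤ := by
  set M := (NonUnitalStarAlgebra.adjoin ℂ (Set.range (ofAHom φ) ∪
      ⋃ i, Set.range ((TLin φ).comp (singleCLM (A := A) i).toLinearMap))).topologicalClosure with hM
  have hMc : IsClosed (M : Set (ToeplitzPimsner φ)) :=
    NonUnitalStarSubalgebra.isClosed_topologicalClosure _
  have hA : ∀ a, ofAHom φ a ∈ M := fun a => NonUnitalStarSubalgebra.le_topologicalClosure _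
    (NonUnitalStarAlgebra.subset_adjoin ℂ _ (Or.inl ⟨a, rfl⟩))
  have hT : ∀ ξ, TLin φ ξ ∈ M := fun ξ => by
    have h := (L2.hasSum_single_apply ξ).map (TLin φ) (continuous_TLin φ)
    refine hMc.mem_of_tendsto h (.of_forall fun s => ?_)
    exact sum_mem fun i _ => NonUnitalStarSubalgebra.le_topologicalClosure _
      (NonUnitalStarAlgebra.subset_adjoin ℂ _ (Or.inr (Set.mem_iUnion.2 ⟨i, ξ i, rfl⟩)))
  let incl : ToeplitzPimsner φ →⋆ₙₐ[ℂ] ToeplitzProduct φ :=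
    NonUnitalStarSubalgebraClass.subtype (toeplitzSubalgebra φ)
  -- The defining closure is taken in the product of all representations. The subalgebra is closed
  -- there, so the image of `M` is closed as well.
  have hle : toeplitzSubalgebra φ ≤ M.map incl := by
    refine NonUnitalStarSubalgebra.topologicalClosure_minimal _
      (NonUnitalStarAlgebra.adjoin_le ?_) ?_
    · rintro _ (⟨a, rfl⟩ | ⟨ξ, rfl⟩)
      · exact ⟨_, hA a, rfl⟩
      · exact ⟨_, hT ξ, rfl⟩
    · exact (NonUnitalStarSubalgebra.isClosed_topologicalClosure _).isClosedEmbedding_subtypeVal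
        |>.isClosedMap _ hMc
  refine top_le_iff.1 fun x _ => ?_
  obtain ⟨y, hy, hxy⟩ := hle x.2
  exact Subtype.ext hxy ▸ hy

end ToeplitzPimsner

variable {A : Type u} [NonUnitalCStarAlgebra A] (ρ : ℕ → A →⋆ₙₐ[ℂ] A)

theorem creation_single (i : ℕ) (a : A) :
    creation ρ (L2.single i a) = fockShift i * fockLeft ρ a := by
  refine (hasSum_creation ρ _).unique ?_
  convert hasSum_single i fun j hj => ?_ using 1
  · rw [L2.single_apply_same]
  · rw [L2.single_apply_of_ne hj, map_zero, mul_zero]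

/-- The Toeplitz--Pimsner algebra with its representation on the full Fock space. -/
def toeplitzFockCover : FockCover ρ (ToeplitzPimsner (leftAction ρ)) where
  π := ToeplitzPimsner.ofAHom (leftAction ρ)
  S i := (ToeplitzPimsner.TLin (leftAction ρ)).comp (singleCLM i).toLinearMap
  F := ToeplitzPimsner.lift (leftAction ρ) (fockRep ρ)
  π_mul_S a i b := (ToeplitzPimsner.ofAHom_mul_TLin (leftAction ρ) a (L2.single i b)).trans
    (congr_arg _ (diagRep_single ρ a i b))
  S_mul_π i a b := (ToeplitzPimsner.TLin_mul_ofAHom (leftAction ρ) (L2.single i a) b).trans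
    (congr_arg _ (rsmul_single i a b))
  star_S_mul_S i j a b :=
    (ToeplitzPimsner.star_TLin_mul_TLin (leftAction ρ) (L2.single i a) (L2.single j b)).trans
      (congr_arg _ (inner_single_single i j a b))
  F_π _ := rfl
  F_S i a := creation_single ρ i a
  dense := ToeplitzPimsner.topologicalClosure_adjoin_eq_top (leftAction ρ)

/-- The zero ideal is one of the closed ideals in the defining infimum, because no nonzero element
acts as a compact operator on the vacuum summand. -/
theorem cuntzPimsnerIdeal_eq_bot (hnorm : ∀ a : A, limsup (fun n => ‖ρ n a‖) atTop = ‖a‖) :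
    cuntzPimsnerIdeal ρ = ⊥ := by
  refine le_bot_iff.1 (sInf_le ⟨?_, fun x hx => ?_⟩)
  · rw [TwoSidedIdeal.coe_bot]
    exact isClosed_singleton
  · rw [TwoSidedIdeal.mem_bot]
    exact (toeplitzFockCover ρ).eq_zero_of_F_mem_vacuumCompacts hnorm hx

theorem bijective_toCuntzPimsner (h : cuntzPimsnerIdeal ρ = ⊥) :
    Function.Bijective (toCuntzPimsner ρ) := by
  refine ⟨fun x y hxy => ?_, Quotient.mk''_surjective⟩
  have h1 : (cuntzPimsnerIdeal ρ).ringCon x y := (RingCon.eq _).1 hxy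
  rw [TwoSidedIdeal.rel_iff, h, TwoSidedIdeal.mem_bot] at h1
  exact sub_eq_zero.1 h1

end Pimsner

end

theorem theorem4p3 {A : Type*} [NonUnitalCStarAlgebra A] [Nontrivial A]
    [TopologicalSpace.SeparableSpace A] (ρ : ℕ → A →⋆ₙₐ[ℂ] A)
    (hnd : ∀ n, Pimsner.IsNondegenerate (ρ n))
    (hnorm : ∀ a : A, Filter.limsup (fun n => ‖ρ n a‖) Filter.atTop = ‖a‖)
    (hideal : ∀ I : TwoSidedIdeal A, IsClosed (I : Set A) →
      (∀ n, ∀ a ∈ I, ρ n a ∈ I) → I = ⊥ ∨ I = ⊤) :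
    Pimsner.IsSimpleCStar (Pimsner.ToeplitzPimsner (Pimsner.leftAction ρ)) ∧
      Function.Bijective (Pimsner.toCuntzPimsner ρ) := by
  refine ⟨⟨?_, fun I hI => (Pimsner.toeplitzFockCover ρ).eq_bot_or_eq_top hnd hnorm hideal hI⟩,
    Pimsner.bijective_toCuntzPimsner ρ (Pimsner.cuntzPimsnerIdeal_eq_bot ρ hnorm)⟩
  obtain ⟨a, ha⟩ := exists_ne (0 : A)
  refine ⟨(Pimsner.toeplitzFockCover ρ).π a, 0, fun h => ha ?_⟩
  rw [← norm_eq_zero, ← (Pimsner.toeplitzFockCover ρ).norm_π, h, norm_zero]
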